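/- Let $H_1,H_2$ be separable infinite-dimensional real Hilbert spaces, let $k,p\ge 0$ be integers, and put $r=k+p$. Let $\mathcal A:H_1\to H_2$ be a Hilbert--Schmidt operator of rank at least $r+2$. For every $n$ let $w^{(n)}_1,\dots,w^{(n)}_n$ be orthonormal in $H_1$, and for every $m$ let $z^{(m)}_1,\dots,z^{(m)}_m$ be orthonormal in $H_2$. Let $W_n:\mathbb R^n\to H_1$, $W_n\xi=\sum_j\xi_jw^{(n)}_j$, and $Z_m:\mathbb R^m\to H_2$, $Z_m\eta=\sum_i\eta_iz^{(m)}_i$, and let $$A_{m,n}=Z_m^*\mathcal AW_n\in\mathbb R^{m\times n},\qquad \mathcal A_{m,n}=Z_mA_{m,n}W_n^*:H_1\to H_2 .$$ Assume that $\|\mathcal A-\mathcal A_{m,n}\|_{\mathrm{HS}}\to 0$ as $m,n\to\infty$. For vectors $x_1,\dots,x_r$ of a Hilbert space let $P_X$ denote the orthogonal projector onto $\operatorname{span}\{x_1,\dots,x_r\}$. For $Y=[y_1,\dots,y_r]$ and $Y_n=[y_{n,1},\dots,y_{n,r}]$ with columns in $H_2$, let $$\widehat{\mathcal A}=P_Y\mathcal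 A,\qquad \widehat{\mathcal A}_{m,n}=Z_m\,P_{Z_m^*Y_n}\,A_{m,n}\,W_n^*,$$ where $Z_m^*Y_n=[Z_m^*y_{n,1},\dots,Z_m^*y_{n,r}]$; these are the outputs of the randomized SVD with $r$ samples applied to $\mathcal A$ with sketch $Y$, and to $A_{m,n}$ with sketch $Z_m^*Y_n$ (if $Y_n=\mathcal AW_n\Omega'_n$ with a Gaussian random matrix $\Omega'_n\in\mathbb R^{n\times r}$, this sketch is $A_{m,n}\Omega_n'$). Let $$\mu=\mathcal N_{H_2}(0,\mathcal A\mathcal A^*),\qquad \mu_n=\mathcal N_{H_2}(0,\mathcal AW_nW_n^*\mathcal A^*)$$ be the centered Gaussian measures on $H_2$ with these covariance operators, and let $\Gamma(\mu_n,\mu)$ be the set of all Borel probability measures on $H_2\times H_2$ with marginals $\mu_n$ and $\mu$. For $\gamma\in\Gamma(\mu_n,\mu)$ let $\mathbb E_{\gamma^{\otimes r}}$ denote the expectation when the $r$ pairs of columns $(y_{n,j},y_j)$, $j=1,\dots,r$, are independent with law $\gamma$. Then $\|\widehat{\mathcal A}-\widehat{\mathcal A}_{m,n}\|_{\mathrm{HS}}$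 is a measurable function of $(Y_n,Y)$ for all $m,n$, and there is a finite constant $C$, independent of $m$ and $n$, such that for all $m,n$ $$\inf_{\gamma\in\Gamma(\mu_n,\mu)}\mathbb E_{\gamma^{\otimes r}}\|\widehat{\mathcal A}-\widehat{\mathcal A}_{m,n}\|_{\mathrm{HS}}\le C\,\|\mathcal A-\mathcal A_{m,n}\|_{\mathrm{HS}} .$$ In particular, $$\lim_{m,n\to\infty}\ \inf_{\gamma\in\Gamma(\mu_n,\mu)}\mathbb E_{\gamma^{\otimes r}}\|\widehat{\mathcal A}-\widehat{\mathcal A}_{m,n}\|_{\mathrm{HS}}=0 .$$ -/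

import Mathlib

open TopologicalSpace MeasureTheory ProbabilityTheory Filter
open scoped ENNReal NNReal Topology InnerProductSpace

namespace RandSVD
section
variable {E F : Type*} [NormedAddCommGroup E] [InnerProductSpace ℝ E] [CompleteSpace E]
  [NormedAddCommGroup F] [InnerProductSpace ℝ F] [CompleteSpace F]

/-- The index set of a chosen orthonormal basis of `E`. -/
noncomputable def basisIndex (E : Type*) [NormedAddCommGroup E] [InnerProductSpace ℝ E]
    [CompleteSpace E] : Set E :=
  (exists_hilbertBasis ℝ E).choose

/-- A chosen orthonormal (Hilbert) basis of `E`. -/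
noncomputable def basis (E : Type*) [NormedAddCommGroup E] [InnerProductSpace ℝ E]
    [CompleteSpace E] : HilbertBasis (basisIndex E) ℝ E :=
  (exists_hilbertBasis ℝ E).choose_spec.choose

/-- The Hilbert--Schmidt norm `(∑ᵢ ‖T eᵢ‖²)^(1/2) ∈ [0, ∞]`, computed in the orthonormal basis
`basis E`. By `hsNorm_eq` every orthonormal basis gives the same value. -/
noncomputable def hsNorm (T : E →L[ℝ] F) : ℝ≥0∞ :=
  (∑' i, ‖T (basis E i)‖ₑ ^ 2) ^ (1 / 2 : ℝ)

/-- `T` is a Hilbert--Schmidt operator. -/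
def IsHilbertSchmidt (T : E →L[ℝ] F) : Prop := hsNorm T < ∞

theorem tsum_enorm_inner_sq {ι : Type*} (b : HilbertBasis ι ℝ E) (x : E) :
    ∑' i, ‖⟪b i, x⟫_ℝ‖ₑ ^ 2 = ‖x‖ₑ ^ 2 := by
  have h := b.hasSum_inner_mul_inner x x
  have h2 : HasSum (fun i => ‖⟪b i, x⟫_ℝ‖ ^ 2) (‖x‖ ^ 2) := by
    rw [← real_inner_self_eq_norm_sq]
    refine h.congr_fun ?_ |> fun h => h
    intro i
    rw [real_inner_comm x (b i), Real.norm_eq_abs, sq_abs, sq]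
  have h3 := ENNReal.ofReal_tsum_of_nonneg (fun i => by positivity) h2.summable
  rw [h2.tsum_eq] at h3
  simpa only [ENNReal.ofReal_pow (norm_nonneg _), ofReal_norm] using h3.symm

theorem tsum_enorm_sq_adjoint {ι κ : Type*} (b : HilbertBasis ι ℝ E) (c : HilbertBasis κ ℝ F)
    (T : E →L[ℝ] F) :
    ∑' i, ‖T (b i)‖ₑ ^ 2 = ∑' j, ‖T.adjoint (c j)‖ₑ ^ 2 := by
  simp_rw [← tsum_enorm_inner_sq b, ← tsum_enorm_inner_sq c]
  rw [ENNReal.tsum_comm]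
  congr! 5 with j i
  rw [ContinuousLinearMap.adjoint_inner_right, real_inner_comm]

/-- The Hilbert--Schmidt norm does not depend on the orthonormal basis. -/
theorem hsNorm_eq {ι : Type*} (b : HilbertBasis ι ℝ E) (T : E →L[ℝ] F) :
    hsNorm T = (∑' i, ‖T (b i)‖ₑ ^ 2) ^ (1 / 2 : ℝ) := by
  rw [hsNorm, tsum_enorm_sq_adjoint _ (basis F), tsum_enorm_sq_adjoint _ (basis F)]

end

section
variable {E : Type*} [NormedAddCommGroup E] [InnerProductSpace ℝ E]

/-- The quasi-matrix `[v₁, …, vₙ]` as the operator `ξ ↦ ∑ i, ξᵢ vᵢ` from `ℝⁿ` to `E`. -/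
noncomputable def quasiMatrix {n : ℕ} (v : Fin n → E) : EuclideanSpace ℝ (Fin n) →L[ℝ] E :=
  ∑ i, (EuclideanSpace.proj i : EuclideanSpace ℝ (Fin n) →L[ℝ] ℝ).smulRight (v i)

@[simp] theorem quasiMatrix_apply {n : ℕ} (v : Fin n → E) (ξ : EuclideanSpace ℝ (Fin n)) :
    quasiMatrix v ξ = ∑ i, ξ i • v i := by
  simp [quasiMatrix]
end
section
variable {E F : Type*} [NormedAddCommGroup E] [InnerProductSpace ℝ E] 
  [NormedAddCommGroup F] [InnerProductSpace ℝ F] 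

/-- The output `Q Q* A` of the randomized SVD with sketch `Y = [y₁, …, yᵣ]`, where `Q` is an
orthonormal basis of `range Y`, i.e. `Q Q*` is the orthogonal projector onto `range Y`. -/
noncomputable def randSVD {r : ℕ} (A : E →L[ℝ] F) (Y : Fin r → F) : E →L[ℝ] F :=
  (LinearMap.range (quasiMatrix Y).toLinearMap).starProjection ∘L A

/-- The output of the randomized SVD, for any orthonormal basis `q` of the range of the sketch. -/
theorem randSVD_eq [CompleteSpace F] {r s : ℕ} (A : E →L[ℝ] F) (Y : Fin r → F) (q : Fin s → F)
    (hq : Orthonormal ℝ q)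
    (hqY : LinearMap.range (quasiMatrix q).toLinearMap = LinearMap.range (quasiMatrix Y).toLinearMap) :
    randSVD A Y = quasiMatrix q ∘L (quasiMatrix q).adjoint ∘L A := by
  ext x
  simp only [randSVD, ContinuousLinearMap.comp_apply]
  refine Submodule.eq_starProjection_of_mem_of_inner_eq_zero ?_ fun y hy => ?_ 
  · rw [← hqY]
    exact ⟨_, rfl⟩
  · rw [← hqY] at hy
    obtain ⟨ξ, rfl⟩ := hy
    have h : (quasiMatrix q).adjoint ∘L quasiMatrix q = ContinuousLinearMap.id ℝ _ := by
      refine ContinuousLinearMap.ext fun η => ext_inner_right ℝ fun ζ => ?_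
      simp only [ContinuousLinearMap.comp_apply, ContinuousLinearMap.adjoint_inner_left,
        ContinuousLinearMap.id_apply, quasiMatrix_apply, hq.inner_sum]
      simp [PiLp.inner_apply, mul_comm]
    have h' := fun η => DFunLike.congr_fun h η
    simp only [ContinuousLinearMap.comp_apply, ContinuousLinearMap.id_apply] at h'
    rw [ContinuousLinearMap.coe_coe, ← ContinuousLinearMap.adjoint_inner_left, map_sub, h', sub_self, inner_zero_left]
end

section
variable {H : Type*} [NormedAddCommGroup H] [InnerProductSpace ℝ H] [CompleteSpace H]
  [MeasurableSpace H] [BorelSpace H] {ι : Type*}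

/-- `μ` is the centered Gaussian measure `N(0, T)` on `H`: it is Gaussian with mean `0` and
covariance operator `T`. -/
structure IsCenteredGaussian (μ : Measure H) (T : H →L[ℝ] H) : Prop where
  isGaussian : IsGaussian μ
  mean_eq_zero : ∫ y, y ∂μ = 0
  covariance_eq : covarianceOperator μ = T

open Classical in
/-- The measure `N(0, T)`. It is unique by `IsCenteredGaussian.unique`, and it exists for the
operators `T = B B*` with `B` Hilbert--Schmidt by `isCenteredGaussian_gaussianMeasure`; the value
`0` is only taken when there is no such measure. -/
noncomputable def gaussianMeasure (T : H →L[ℝ] H) : Measure H :=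
  if h : ∃ μ : Measure H, IsCenteredGaussian μ T then h.choose else 0

theorem IsCenteredGaussian.covarianceBilin_apply [SeparableSpace H] {μ : Measure H} {T : H →L[ℝ] H}
    (h : IsCenteredGaussian μ T) (x y : H) : covarianceBilin μ x y = ⟪T x, y⟫_ℝ := by
  have : SecondCountableTopology H := UniformSpace.secondCountable_of_separable H
  have := h.isGaussian
  have h2 : MemLp id 2 μ := IsGaussian.memLp_two_id
  rw [ProbabilityTheory.covarianceBilin_apply h2, ← h.covariance_eq, covarianceOperator_inner h2]
  simp [h.mean_eq_zero]

/-- There is at most one centered Gaussian measure with a given covariance operator. -/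
theorem IsCenteredGaussian.unique [SeparableSpace H] {μ ν : Measure H} {T : H →L[ℝ] H}
    (hμ : IsCenteredGaussian μ T) (hν : IsCenteredGaussian ν T) : μ = ν := by
  have : SecondCountableTopology H := UniformSpace.secondCountable_of_separable H
  have := hμ.isGaussian
  have := hν.isGaussian
  refine IsGaussian.ext ?_ ?_
  · simp only [id, hμ.mean_eq_zero, hν.mean_eq_zero]
  · ext x y
    rw [hμ.covarianceBilin_apply, hν.covarianceBilin_apply]

/-- Independent standard Gaussian variables indexed by `ι`. -/
noncomputable abbrev whiteNoise (ι : Type*) : Measure (ι → ℝ) :=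
  Measure.infinitePi fun _ => gaussianReal 0 1

theorem measurable_coord (i : ι) : Measurable fun ω : ι → ℝ => ω i := measurable_pi_apply i

theorem map_coord (i : ι) : (whiteNoise ι).map (fun ω => ω i) = gaussianReal 0 1 :=
  Measure.infinitePi_map_eval (fun _ : ι => gaussianReal 0 1) i

theorem memLp_coord (i : ι) : MemLp (fun ω : ι → ℝ => ω i) 2 (whiteNoise ι) := by
  have h := (memLp_id_gaussianReal' (μ := 0) (v := 1) 2 (by simp))
  rw [← map_coord i,
    memLp_map_measure_iff aestronglyMeasurable_id (measurable_coord i).aemeasurable] at h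
  exact h

theorem memLp_coord_smul (i : ι) (v : H) :
    MemLp (fun ω : ι → ℝ => ω i • v) 2 (whiteNoise ι) :=
  ((ContinuousLinearMap.id ℝ ℝ).smulRight v).comp_memLp' (memLp_coord i)

theorem integral_coord_sq (i : ι) : ∫ ω : ι → ℝ, ω i * ω i ∂(whiteNoise ι) = 1 := by
  have h := integral_map (μ := whiteNoise ι) (φ := fun ω => ω i) (f := fun x : ℝ => x * x)
    (measurable_coord i).aemeasurable (by fun_prop)
  rw [← h, map_coord]
  have := variance_eq_sub (memLp_id_gaussianReal' (μ := 0) (v := 1) 2 (by simp))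
  simp only [variance_id_gaussianReal, integral_id_gaussianReal, id] at this
  simpa [sq] using this.symm

theorem integral_coord_mul {i j : ι} (hij : i ≠ j) :
    ∫ ω : ι → ℝ, ω i * ω j ∂(whiteNoise ι) = 0 := by
  have hI : iIndepFun (fun (i : ι) (ω : ι → ℝ) => ω i) (whiteNoise ι) :=
    iIndepFun_infinitePi (X := fun _ (x : ℝ) => x) (by fun_prop)
  rw [(hI.indepFun hij).integral_fun_mul_eq_mul_integral
    (measurable_coord i).aestronglyMeasurable (measurable_coord j).aestronglyMeasurable]
  have h := integral_map (μ := whiteNoise ι) (φ := fun ω => ω i) (f := fun x : ℝ => x)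
    (measurable_coord i).aemeasurable (by fun_prop)
  rw [← h, map_coord]
  simp [integral_id_gaussianReal]

/-- `v ↦ ωᵢ v` as an isometry into the square-integrable random elements. -/
noncomputable def coordIsometry (i : ι) : H →ₗᵢ[ℝ] Lp H 2 (whiteNoise ι) :=
  LinearMap.isometryOfInner
    { toFun := fun v => (memLp_coord_smul i v).toLp
      map_add' := fun v w => by
        rw [← MemLp.toLp_add]
        exact MemLp.toLp_congr _ _ (.of_forall fun ω => smul_add _ _ _)
      map_smul' := fun c v => by
        rw [RingHom.id_apply, ← MemLp.toLp_const_smul]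
        exact MemLp.toLp_congr _ _ (.of_forall fun ω => smul_comm _ _ _) }
    (fun v w => by
      simp only [LinearMap.coe_mk, AddHom.coe_mk, L2.inner_def]
      calc _ = ∫ ω : ι → ℝ, (ω i * ω i) * ⟪v, w⟫_ℝ ∂(whiteNoise ι) := by
            refine integral_congr_ae ?_
            filter_upwards [(memLp_coord_smul i v).coeFn_toLp,
              (memLp_coord_smul i w).coeFn_toLp] with ω h1 h2
            rw [h1, h2, real_inner_smul_left, real_inner_smul_right, mul_assoc]
        _ = _ := by rw [integral_mul_const, integral_coord_sq, one_mul])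

theorem coordIsometry_coe (i : ι) (v : H) :
    coordIsometry i v =ᵐ[whiteNoise ι] fun ω => ω i • v :=
  (memLp_coord_smul i v).coeFn_toLp

theorem orthogonalFamily_coord :
    OrthogonalFamily ℝ (fun _ : ι => H) (fun i => coordIsometry (H := H) i) := by
  intro i j hij v w
  rw [L2.inner_def]
  calc _ = ∫ ω : ι → ℝ, (ω i * ω j) * ⟪v, w⟫_ℝ ∂(whiteNoise ι) := by
        refine integral_congr_ae ?_
        filter_upwards [coordIsometry_coe i v, coordIsometry_coe j w] with ω h1 h2
        rw [h1, h2, real_inner_smul_left, real_inner_smul_right, mul_assoc]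
    _ = _ := by rw [integral_mul_const, integral_coord_mul hij, zero_mul]

theorem norm_charFun_sub_le {Ω : Type*} [MeasurableSpace Ω] {P : Measure Ω}
    [IsProbabilityMeasure P] (X S : Lp H 2 P) (t : H) :
    ‖charFun (P.map X) t - charFun (P.map S) t‖ ≤ ‖t‖ * ‖X - S‖ := by
  have hm (X : Lp H 2 P) : AEStronglyMeasurable X P := Lp.aestronglyMeasurable X
  have hi (X : Lp H 2 P) : Integrable (fun ω => Complex.exp (⟪X ω, t⟫_ℝ * Complex.I)) P := by
    refine Integrable.of_bound (C := 1) ?_ (.of_forall fun ω => ?_)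
    · have : Continuous fun x : H => Complex.exp (⟪x, t⟫_ℝ * Complex.I) := by fun_prop
      exact this.comp_aestronglyMeasurable (hm X)
    · rw [Complex.norm_exp_ofReal_mul_I]
  have hc (X : Lp H 2 P) : charFun (P.map X) t =
      ∫ ω, Complex.exp (⟪X ω, t⟫_ℝ * Complex.I) ∂P := by
    rw [charFun_apply, integral_map (hm X).aemeasurable]
    have : Measurable fun x : H => Complex.exp (⟪x, t⟫_ℝ * Complex.I) :=
      (by fun_prop : Continuous _).measurable
    exact this.aestronglyMeasurable
  have hint : Integrable (X - S : Lp H 2 P) P :=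
    (Lp.memLp (X - S)).integrable (by norm_num)
  rw [hc, hc, ← integral_sub (hi X) (hi S)]
  calc _ ≤ ∫ ω, ‖t‖ * ‖(X - S : Lp H 2 P) ω‖ ∂P := by
        refine norm_integral_le_of_norm_le (hint.norm.const_mul _) ?_
        filter_upwards [Lp.coeFn_sub X S] with ω h
        rw [h, Pi.sub_apply]
        have e : Complex.exp (⟪X ω, t⟫_ℝ * Complex.I) - Complex.exp (⟪S ω, t⟫_ℝ * Complex.I)
            = Complex.exp (⟪S ω, t⟫_ℝ * Complex.I) *
              (Complex.exp (Complex.I * (⟪X ω - S ω, t⟫_ℝ : ℝ)) - 1) := by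
          rw [mul_sub, ← Complex.exp_add, inner_sub_left, mul_one]
          congr 2
          push_cast
          ring
        rw [e, norm_mul, Complex.norm_exp_ofReal_mul_I, one_mul]
        refine Real.norm_exp_I_mul_ofReal_sub_one_le.trans ?_
        rw [mul_comm]
        exact norm_inner_le_norm _ _
    _ = ‖t‖ * ∫ ω, ‖(X - S : Lp H 2 P) ω‖ ∂P := integral_const_mul _ _
    _ ≤ _ := by
        gcongr
        rw [Lp.norm_def, integral_norm_eq_lintegral_enorm (hm _),
          ← eLpNorm_one_eq_lintegral_enorm]
        exact ENNReal.toReal_mono (Lp.eLpNorm_ne_top _)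
          (eLpNorm_le_eLpNorm_of_exponent_le (by norm_num) (hm _))

theorem charFun_partialSum (a : ι → H) (s : Finset ι) (t : H) :
    charFun ((whiteNoise ι).map (∑ i ∈ s, coordIsometry i (a i) : Lp H 2 (whiteNoise ι))) t =
      Complex.exp ((-(∑ i ∈ s, ⟪a i, t⟫_ℝ ^ 2) / 2 : ℝ)) := by
  have hI : iIndepFun (fun (i : ι) (ω : ι → ℝ) => ⟪a i, t⟫_ℝ * ω i) (whiteNoise ι) :=
    iIndepFun_infinitePi (X := fun i (x : ℝ) => ⟪a i, t⟫_ℝ * x) (fun i => by fun_prop)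
  have hme (i : ι) : Measurable fun ω : ι → ℝ => ⟪a i, t⟫_ℝ * ω i :=
    (measurable_coord i).const_mul _
  have hms : Measurable fun ω : ι → ℝ => ∑ i ∈ s, ⟪a i, t⟫_ℝ * ω i :=
    Finset.measurable_fun_sum s fun i _ => hme i
  have hcoe : ((∑ i ∈ s, coordIsometry i (a i) : Lp H 2 (whiteNoise ι)) : (ι → ℝ) → H)
      =ᵐ[whiteNoise ι] fun ω => ∑ i ∈ s, ω i • a i := by
    have h := (ae_ball_iff s.countable_toSet).2 fun i (_ : i ∈ (s : Set ι)) =>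
      coordIsometry_coe i (a i)
    filter_upwards [Lp.coeFn_fun_finsetSum s fun i => coordIsometry i (a i), h] with ω h1 h2
    rw [h1]
    exact Finset.sum_congr rfl fun i hi => h2 i hi
  have hone (i : ι) : charFun ((whiteNoise ι).map fun ω => ⟪a i, t⟫_ℝ * ω i) 1 =
      Complex.exp ((-(⟪a i, t⟫_ℝ ^ 2) / 2 : ℝ)) := by
    have : (whiteNoise ι).map (fun ω => ⟪a i, t⟫_ℝ * ω i) =
        ((whiteNoise ι).map fun ω => ω i).map (⟪a i, t⟫_ℝ * ·) := by
      rw [Measure.map_map (by fun_prop) (measurable_coord i)]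
      rfl
    rw [this, map_coord, charFun_map_mul, charFun_gaussianReal]
    push_cast
    congr 1
    simp
    ring
  have hkey : charFun ((whiteNoise ι).map
      (∑ i ∈ s, coordIsometry i (a i) : Lp H 2 (whiteNoise ι))) t =
      charFun ((whiteNoise ι).map fun ω => ∑ i ∈ s, ⟪a i, t⟫_ℝ * ω i) 1 := by
    have hcont : Measurable fun x : H => Complex.exp (⟪x, t⟫_ℝ * Complex.I) :=
      (by fun_prop : Continuous _).measurable
    rw [charFun_apply, charFun_apply, integral_map (Lp.aestronglyMeasurable _).aemeasurable
      hcont.aestronglyMeasurable, integral_map hms.aemeasurable (by fun_prop)]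
    refine integral_congr_ae ?_
    filter_upwards [hcoe] with ω h
    rw [h, sum_inner]
    simp [real_inner_smul_left, mul_comm]
  rw [hkey, iIndepFun.charFun_map_fun_finsetSum_eq_prod (fun i _ => (hme i).aemeasurable)
    (hI.restrict _), Finset.prod_apply]
  simp_rw [hone]
  rw [← Complex.exp_sum]
  congr 1
  push_cast
  rw [← Finset.sum_neg_distrib, Finset.sum_div]

theorem exists_charFun (a : ι → H) (ha : Summable fun i => ‖a i‖ ^ 2) :
    ∃ μ : Measure H, IsProbabilityMeasure μ ∧ ∀ t,
      charFun μ t = Complex.exp ((-(∑' i, ⟪a i, t⟫_ℝ ^ 2) / 2 : ℝ)) := by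
  obtain ⟨X, hX⟩ := (orthogonalFamily_coord.summable_iff_norm_sq_summable a).2 ha
  refine ⟨(whiteNoise ι).map X, Measure.isProbabilityMeasure_map
    (Lp.aestronglyMeasurable X).aemeasurable, fun t => ?_⟩
  have h1 : Tendsto (fun s : Finset ι => charFun ((whiteNoise ι).map
      (∑ i ∈ s, coordIsometry i (a i) : Lp H 2 (whiteNoise ι))) t) atTop
      (𝓝 (charFun ((whiteNoise ι).map X) t)) := by
    rw [tendsto_iff_norm_sub_tendsto_zero]
    have h0 : Tendsto (fun s : Finset ι => ‖t‖ *
        ‖(∑ i ∈ s, coordIsometry i (a i) : Lp H 2 (whiteNoise ι)) - X‖) atTop (𝓝 0) := by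
      simpa using (tendsto_iff_norm_sub_tendsto_zero.1 hX).const_mul ‖t‖
    exact squeeze_zero (fun _ => norm_nonneg _) (fun s => norm_charFun_sub_le _ _ t) h0
  refine tendsto_nhds_unique h1 ?_
  simp_rw [charFun_partialSum]
  have hs : Summable fun i => ⟪a i, t⟫_ℝ ^ 2 := by
    refine Summable.of_nonneg_of_le (fun i => sq_nonneg _) (fun i => ?_) (ha.mul_right (‖t‖ ^ 2))
    rw [← mul_pow, sq_le_sq, abs_of_nonneg (by positivity : 0 ≤ ‖a i‖ * ‖t‖)]
    exact abs_real_inner_le_norm _ _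
  have hc : Continuous fun x : ℝ => Complex.exp ((-x / 2 : ℝ)) := by fun_prop
  exact (hc.tendsto _).comp hs.hasSum


/-- If `B` is Hilbert--Schmidt, then the centered Gaussian measure with covariance operator
`B B*` exists. -/
theorem exists_isCenteredGaussian [SeparableSpace H] {E : Type*} [NormedAddCommGroup E]
    [InnerProductSpace ℝ E] [CompleteSpace E] {B : E →L[ℝ] H} (hB : IsHilbertSchmidt B) :
    ∃ μ : Measure H, IsCenteredGaussian μ (B ∘L B.adjoint) := by
  have : SecondCountableTopology H := UniformSpace.secondCountable_of_separable H
  have hne : ∑' i, ENNReal.ofReal (‖B (basis E i)‖ ^ 2) ≠ ∞ := by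
    have h := hB.ne
    rw [hsNorm] at h
    intro h0
    simp only [ENNReal.ofReal_pow (norm_nonneg _), ofReal_norm] at h0
    rw [h0] at h
    simp at h
  have hs : Summable fun i => ‖B (basis E i)‖ ^ 2 := by
    have := ENNReal.summable_toReal hne
    simpa [ENNReal.toReal_ofReal] using this
  obtain ⟨μ, hμ, hc⟩ := exists_charFun _ hs
  have hp (x : H) : ∑' i, ⟪B (basis E i), x⟫_ℝ ^ 2 = ⟪(B ∘L B.adjoint) x, x⟫_ℝ := by
    rw [ContinuousLinearMap.comp_apply, ← ContinuousLinearMap.adjoint_inner_right,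
      ← (basis E).tsum_inner_mul_inner]
    refine tsum_congr fun i => ?_
    rw [real_inner_comm (basis E i), ContinuousLinearMap.adjoint_inner_right, sq]
  let f : H →L[ℝ] H →L[ℝ] ℝ := (innerSL ℝ) ∘L (B ∘L B.adjoint)
  have hf0 (x y : H) : f x y = ⟪(B ∘L B.adjoint) x, y⟫_ℝ := rfl
  have hfa (x y : H) : f x y = ⟪B.adjoint x, B.adjoint y⟫_ℝ := by
    rw [hf0, ContinuousLinearMap.comp_apply, ContinuousLinearMap.adjoint_inner_right]
  have hf : f.toBilinForm.IsPosSemidef :=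
    { eq := fun x y => by
        simp only [ContinuousLinearMap.toBilinForm_apply, hfa]
        exact real_inner_comm _ _
      nonneg := fun x => by
        simp only [ContinuousLinearMap.toBilinForm_apply, hfa]
        exact real_inner_self_nonneg }
  have hch : ∀ t, charFun μ t = Complex.exp (⟪t, (0 : H)⟫_ℝ * Complex.I - f t t / 2) := by
    intro t
    rw [hc, hp]
    congr 1
    rw [hf0, inner_zero_right]
    push_cast
    ring
  obtain ⟨h0, h1⟩ := gaussian_charFun_congr 0 f hf hch
  have hG : IsGaussian μ := isGaussian_iff_gaussian_charFun.2 ⟨0, f, hf, hch⟩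
  refine ⟨μ, hG, h0.symm, ?_⟩
  have h2 : MemLp id 2 μ := IsGaussian.memLp_two_id
  ext x
  refine ext_inner_right ℝ fun y => ?_
  have h3 := ProbabilityTheory.covarianceBilin_apply h2 x y
  rw [covarianceOperator_inner h2]
  rw [← h1] at h3
  simp only [id, ← h0, sub_zero] at h3
  rw [← h3]
  rfl

theorem isCenteredGaussian_gaussianMeasure [SeparableSpace H] {E : Type*} [NormedAddCommGroup E]
    [InnerProductSpace ℝ E] [CompleteSpace E] {B : E →L[ℝ] H} (hB : IsHilbertSchmidt B) :
    IsCenteredGaussian (gaussianMeasure (B ∘L B.adjoint)) (B ∘L B.adjoint) := by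
  have h := exists_isCenteredGaussian hB
  rw [gaussianMeasure, dif_pos h]
  exact h.choose_spec

end

section
variable {H₁ H₂ : Type*}
  [NormedAddCommGroup H₁] [InnerProductSpace ℝ H₁] [CompleteSpace H₁]
  [NormedAddCommGroup H₂] [InnerProductSpace ℝ H₂] [CompleteSpace H₂]

/-- The discretization `A_{m,n} = Z* A W`, an operator from `ℝⁿ` to `ℝᵐ`, for the quasi-matrices
`W = [w₁, …, wₙ]` and `Z = [z₁, …, zₘ]`. -/
noncomputable def discretization (A : H₁ →L[ℝ] H₂) {m n : ℕ} (w : Fin n → H₁) (z : Fin m → H₂) :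
    EuclideanSpace ℝ (Fin n) →L[ℝ] EuclideanSpace ℝ (Fin m) :=
  (quasiMatrix z).adjoint ∘L A ∘L quasiMatrix w

/-- The entries of the matrix of `A_{m,n}`. -/
theorem discretization_entry (A : H₁ →L[ℝ] H₂) {m n : ℕ} (w : Fin n → H₁) (z : Fin m → H₂)
    (i : Fin m) (j : Fin n) :
    discretization A w z (EuclideanSpace.single j 1) i = ⟪z i, A (w j)⟫_ℝ := by
  have h : ⟪EuclideanSpace.single i (1 : ℝ),
      discretization A w z (EuclideanSpace.single j 1)⟫_ℝ = ⟪z i, A (w j)⟫_ℝ := by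
    simp only [discretization, ContinuousLinearMap.comp_apply,
      ContinuousLinearMap.adjoint_inner_right, quasiMatrix_apply]
    simp
  rw [← h]
  simp [EuclideanSpace.inner_single_left]

/-- The compression `Z A_{m,n} W*` of `A`, an operator from `H₁` to `H₂`. -/
noncomputable def compression (A : H₁ →L[ℝ] H₂) {m n : ℕ} (w : Fin n → H₁) (z : Fin m → H₂) :
    H₁ →L[ℝ] H₂ :=
  quasiMatrix z ∘L discretization A w z ∘L (quasiMatrix w).adjoint

/-- The randomized SVD of the discretization `A_{m,n}`, as an operator from `H₁` to `H₂`.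
The argument `Yn` stands for `A W Ω'` with a Gaussian matrix `Ω'`, so that the sketch `A_{m,n} Ω'`
of the discretization is `Z* Yn`. -/
noncomputable def discreteRandSVD (A : H₁ →L[ℝ] H₂) {m n r : ℕ} (w : Fin n → H₁) (z : Fin m → H₂)
    (Yn : Fin r → H₂) : H₁ →L[ℝ] H₂ :=
  quasiMatrix z ∘L
    randSVD (discretization A w z) (fun j => (quasiMatrix z).adjoint (Yn j)) ∘L
      (quasiMatrix w).adjoint

/-- The difference of the two randomized SVDs in Hilbert--Schmidt norm. The `j`-th entry of the
sample `S` is the pair of the `j`-th columns of `Yn` and `Y`, in this order. -/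
noncomputable def sampleError (A : H₁ →L[ℝ] H₂) {m n r : ℕ} (w : Fin n → H₁) (z : Fin m → H₂)
    (S : Fin r → H₂ × H₂) : ℝ≥0∞ :=
  hsNorm (randSVD A (fun j => (S j).2) - discreteRandSVD A w z (fun j => (S j).1))

variable [MeasurableSpace H₂]

/-- The couplings of two measures: all measures on the product with the given marginals. -/
def couplings (μ ν : Measure H₂) : Set (Measure (H₂ × H₂)) :=
  {γ | γ.map Prod.fst = μ ∧ γ.map Prod.snd = ν}

variable [BorelSpace H₂]

/-- `μ = N(0, A A*)`. -/
noncomputable def sketchMeasure (A : H₁ →L[ℝ] H₂) : Measure H₂ :=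
  gaussianMeasure (A ∘L A.adjoint)

/-- `μₙ = N(0, A W W* A*)`. -/
noncomputable def discreteSketchMeasure (A : H₁ →L[ℝ] H₂) {n : ℕ} (w : Fin n → H₁) :
    Measure H₂ :=
  gaussianMeasure (A ∘L quasiMatrix w ∘L (quasiMatrix w).adjoint ∘L A.adjoint)

theorem isCenteredGaussian_sketchMeasure [SeparableSpace H₂] {A : H₁ →L[ℝ] H₂}
    (hA : IsHilbertSchmidt A) : IsCenteredGaussian (sketchMeasure A) (A ∘L A.adjoint) :=
  isCenteredGaussian_gaussianMeasure hA

theorem isCenteredGaussian_discreteSketchMeasure [SeparableSpace H₂] (A : H₁ →L[ℝ] H₂) {n : ℕ}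
    (w : Fin n → H₁) : IsCenteredGaussian (discreteSketchMeasure A w)
      (A ∘L quasiMatrix w ∘L (quasiMatrix w).adjoint ∘L A.adjoint) := by
  have h : A ∘L quasiMatrix w ∘L (quasiMatrix w).adjoint ∘L A.adjoint =
      (A ∘L quasiMatrix w) ∘L (A ∘L quasiMatrix w).adjoint := by
    rw [ContinuousLinearMap.adjoint_comp]
    rfl
  have hB : IsHilbertSchmidt (A ∘L quasiMatrix w) := by
    rw [IsHilbertSchmidt, hsNorm_eq (EuclideanSpace.basisFun (Fin n) ℝ).toHilbertBasis,
      tsum_fintype]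
    refine ENNReal.rpow_lt_top_of_nonneg (by norm_num) (ENNReal.sum_lt_top.2 fun i _ => ?_).ne
    exact ENNReal.pow_lt_top enorm_lt_top
  rw [discreteSketchMeasure, h]
  exact isCenteredGaussian_gaussianMeasure hB

/-- The infimum over all couplings `γ` of `μₙ` and `μ` of the expected error, where the `r` pairs of
columns are independent with law `γ`. -/
noncomputable def coupledError (A : H₁ →L[ℝ] H₂) {m n : ℕ} (r : ℕ) (w : Fin n → H₁)
    (z : Fin m → H₂) : ℝ≥0∞ :=
  ⨅ γ ∈ couplings (discreteSketchMeasure A w) (sketchMeasure A),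
    ∫⁻ S : Fin r → H₂ × H₂, sampleError A w z S ∂(Measure.pi fun _ => γ)

end
end RandSVD

/-! Since `Z` is an isometry, the discrete output is the randomized SVD of the compression `A_{m,n}`
with sketch `Z Z* Y_n`. With `P` and `P'` the projectors onto the spans of `Y` and `Z Z* Y_n`, the
error is `P'(A - A_{m,n}) + (P - P')A`. The first term is at most `h = ‖A - A_{m,n}‖_HS`, so
everything rests on `‖P - P'‖`.

Let `d_j` be the distance of `y_j` to the span of the other columns. A vector `∑ ξ_j y_j` has `|ξ_j|
d_j` at most its norm, which gives `‖P - P'‖ ≤ 4 ∑ ‖y_j - Z Z* y_{n,j}‖ / d_j`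
(`enorm_starProjection_sub_le`). Only the fixed sketch `Y` occurs in the denominators, so no
nondegeneracy of the discrete sketch is needed.

The coupling feeds the same Gaussian noise into `A` and `A W W*`. Then `y - Z Z* y_n` is Gaussian
with covariance factor `A - A_{m,n}`, and its second moment is exactly `h²` (`exists_coupling`).
Cauchy–Schwarz leaves `E d_j⁻²`, a quantity free of `m` and `n`. As `A` has rank at least `r + 2`,
three directions remain orthogonal to the other `r - 1` columns in which `y_j` has independent
standard normal coordinates, and the inverse of a sum of three such squares is integrable
(`exists_lintegral_inv_residual_sq_le`). -/

namespace RandSVD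

/-! ### Hilbert–Schmidt norm: inequalities and measurability -/

section
variable {E F G : Type*} [NormedAddCommGroup E] [InnerProductSpace ℝ E] [CompleteSpace E]
  [NormedAddCommGroup F] [InnerProductSpace ℝ F] [CompleteSpace F]
  [NormedAddCommGroup G] [InnerProductSpace ℝ G] [CompleteSpace G]

omit [CompleteSpace F] in
theorem hsNorm_sq (T : E →L[ℝ] F) : hsNorm T ^ 2 = ∑' i, ‖T (basis E i)‖ₑ ^ 2 := by
  rw [hsNorm, ← ENNReal.rpow_natCast, ← ENNReal.rpow_mul]
  norm_num

omit [CompleteSpace F] in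
theorem hsNorm_add_le (S T : E →L[ℝ] F) : hsNorm (S + T) ≤ hsNorm S + hsNorm T := by
  let _ : MeasurableSpace (basisIndex E) := ⊤
  have h := ENNReal.lintegral_Lp_add_le (μ := Measure.count (α := basisIndex E)) (p := 2)
    (f := fun i => ‖S (basis E i)‖ₑ) (g := fun i => ‖T (basis E i)‖ₑ)
    measurable_from_top.aemeasurable measurable_from_top.aemeasurable (by norm_num)
  simp only [lintegral_count, Pi.add_apply, ENNReal.rpow_two] at h
  refine le_trans ?_ h
  unfold hsNorm
  gcongr
  exact enorm_add_le _ _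

omit [CompleteSpace F] [CompleteSpace G] in
theorem hsNorm_comp_le (C : F →L[ℝ] G) (T : E →L[ℝ] F) : hsNorm (C ∘L T) ≤ ‖C‖ₑ * hsNorm T := by
  rw [← ENNReal.pow_le_pow_left_iff (n := 2) two_ne_zero, mul_pow, hsNorm_sq, hsNorm_sq,
    ← ENNReal.tsum_mul_left]
  refine ENNReal.tsum_le_tsum fun i => ?_
  rw [← mul_pow]
  gcongr
  exact C.le_opENorm _

omit [CompleteSpace E] in
/-- An orthonormal basis of a separable space is countable. -/
theorem countable_hilbertBasis [SeparableSpace E] {ι : Type*} (b : HilbertBasis ι ℝ E) :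
    Countable ι := by
  refine Pairwise.countable_of_isOpen_disjoint (s := fun i => Metric.ball (b i) (1 / 2))
    (fun i j hij => ?_) (fun i => Metric.isOpen_ball) (fun i => Metric.nonempty_ball.2 (by norm_num))
  refine Metric.ball_disjoint_ball ?_
  have h : ‖b i - b j‖ ^ 2 = 2 := by
    rw [@norm_sub_sq_real, b.orthonormal.norm_eq_one, b.orthonormal.norm_eq_one,
      b.orthonormal.inner_eq_zero hij]
    norm_num
  rw [dist_eq_norm]
  nlinarith [norm_nonneg (b i - b j)]

/-- By Parseval the norm is a countable sum of squared matrix entries, so weak measurability of the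
operator suffices. -/
theorem measurable_hsNorm [SeparableSpace E] [SeparableSpace F] {Ω : Type*} [MeasurableSpace Ω]
    {T : Ω → E →L[ℝ] F} (hT : ∀ x y, Measurable fun ω => ⟪y, T ω x⟫_ℝ) :
    Measurable fun ω => hsNorm (T ω) := by
  have := countable_hilbertBasis (basis E)
  have := countable_hilbertBasis (basis F)
  unfold hsNorm
  simp_rw [← tsum_enorm_inner_sq (basis F)]
  refine Measurable.pow_const (Measurable.tsum fun i => Measurable.tsum fun j => ?_) _
  exact (hT _ _).enorm.pow_const 2

end

/-! ### Distance to the span of a sketch, and measurability of the projector -/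

section
variable {F : Type*} [NormedAddCommGroup F] [InnerProductSpace ℝ F]

/-- The range of the quasi-matrix `Y`, i.e. the span of its columns. -/
noncomputable abbrev colSpan {r : ℕ} (Y : Fin r → F) : Submodule ℝ F :=
  LinearMap.range (quasiMatrix Y).toLinearMap

theorem mem_colSpan {r : ℕ} (Y : Fin r → F) (j : Fin r) : Y j ∈ colSpan Y :=
  ⟨EuclideanSpace.single j 1, by simp⟩

/-- The distance of `x` to the span of `Y`. -/
noncomputable def residual {r : ℕ} (x : F) (Y : Fin r → F) : ℝ≥0∞ :=
  ‖x - (colSpan Y).starProjection x‖ₑ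

theorem norm_sub_starProjection_le (K : Submodule ℝ F) [K.HasOrthogonalProjection] (x : F) {y : F}
    (hy : y ∈ K) : ‖x - K.starProjection x‖ ≤ ‖x - y‖ := by
  rw [Submodule.starProjection_minimal]
  exact ciInf_le ⟨0, by rintro _ ⟨a, rfl⟩; positivity⟩ (⟨y, hy⟩ : K)

theorem residual_eq_iInf {r : ℕ} (x : F) (Y : Fin r → F) :
    residual x Y = ⨅ ξ, ‖x - quasiMatrix Y ξ‖ₑ := by
  refine le_antisymm (le_iInf fun ξ => ?_) ?_
  · exact enorm_le_iff_norm_le.2 (norm_sub_starProjection_le (colSpan Y) x ⟨ξ, rfl⟩)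
  · obtain ⟨ξ, hξ⟩ : (colSpan Y).starProjection x ∈ colSpan Y :=
      Submodule.starProjection_apply_mem _ _
    refine (iInf_le _ ξ).trans_eq ?_
    rw [residual, ← hξ]
    rfl

/-- For fixed coefficients the distance is continuous in the vector and the columns, and the
residual is the infimum over coefficients. This gives measurability also where the rank drops and
the projector is discontinuous. -/
theorem upperSemicontinuous_residual (r : ℕ) :
    UpperSemicontinuous fun q : F × (Fin r → F) => residual q.1 q.2 := by
  simp_rw [residual_eq_iInf, quasiMatrix_apply]
  refine upperSemicontinuous_iInf fun ξ => Continuous.upperSemicontinuous ?_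
  fun_prop

variable [SeparableSpace F] [MeasurableSpace F] [BorelSpace F]

theorem measurable_residual (r : ℕ) :
    Measurable fun q : F × (Fin r → F) => residual q.1 q.2 := by
  have : SecondCountableTopology F := UniformSpace.secondCountable_of_separable F
  exact (upperSemicontinuous_residual r).measurable

/-- Pythagoras expresses `‖P u‖²` through the residual of `u`, and polarization recovers the matrix
entries of `P`. -/
theorem measurable_inner_starProjection {Ω : Type*} [MeasurableSpace Ω] {r : ℕ}
    {Y : Ω → Fin r → F} (hY : Measurable Y) (x v : F) :
    Measurable fun ω => ⟪v, (colSpan (Y ω)).starProjection x⟫_ℝ := by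
  have hn (u : F) : Measurable fun ω => ‖(colSpan (Y ω)).starProjection u‖ ^ 2 := by
    have h (ω) : ‖(colSpan (Y ω)).starProjection u‖ ^ 2 =
        ‖u‖ ^ 2 - (residual u (Y ω)).toReal ^ 2 := by
      have := (colSpan (Y ω)).norm_sq_eq_add_norm_sq_starProjection u
      rw [Submodule.starProjection_orthogonal', sub_apply,
        one_apply_eq_self] at this
      rw [residual, toReal_enorm]
      linarith
    simp_rw [h]
    have := (measurable_residual (F := F) r).comp (measurable_const.prodMk hY : Measurable fun ω => (u, Y ω))
    exact (this.ennreal_toReal.pow_const 2).const_sub _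
  have h (ω) : ⟪v, (colSpan (Y ω)).starProjection x⟫_ℝ =
      (‖(colSpan (Y ω)).starProjection (v + x)‖ ^ 2 -
        ‖(colSpan (Y ω)).starProjection (v - x)‖ ^ 2) / 4 := by
    have h1 : ⟪v, (colSpan (Y ω)).starProjection x⟫_ℝ =
        ⟪(colSpan (Y ω)).starProjection v, (colSpan (Y ω)).starProjection x⟫_ℝ := by
      rw [Submodule.inner_starProjection_left_eq_right,
        Submodule.starProjection_eq_self_iff.2 (Submodule.starProjection_apply_mem _ _)]
    rw [h1, map_add, map_sub, @norm_add_sq_real, @norm_sub_sq_real]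
    ring
  simp_rw [h]
  exact ((hn _).sub (hn _)).div_const _

end

/-! ### The discrete output as a randomized SVD on the full spaces -/

section
variable {H₁ H₂ : Type*}
  [NormedAddCommGroup H₁] [InnerProductSpace ℝ H₁] [CompleteSpace H₁]
  [NormedAddCommGroup H₂] [InnerProductSpace ℝ H₂] [CompleteSpace H₂]

/-- The orthogonal projector `Z Z*` for an orthonormal family `Z`. -/
noncomputable abbrev frameProj {E : Type*} [NormedAddCommGroup E] [InnerProductSpace ℝ E]
    [CompleteSpace E] {m : ℕ} (z : Fin m → E) : E →L[ℝ] E :=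
  quasiMatrix z ∘L (quasiMatrix z).adjoint

/-- The quasi-matrix of an orthonormal family is an isometry. -/
noncomputable def quasiMatrixIsometry {E : Type*} [NormedAddCommGroup E] [InnerProductSpace ℝ E]
    {m : ℕ} {z : Fin m → E} (hz : Orthonormal ℝ z) : EuclideanSpace ℝ (Fin m) →ₗᵢ[ℝ] E :=
  LinearMap.isometryOfInner (quasiMatrix z).toLinearMap fun η ζ => by
    simp only [ContinuousLinearMap.coe_coe, quasiMatrix_apply, hz.inner_sum]
    simp [PiLp.inner_apply, mul_comm]

/-- An isometry carries the projector onto a subspace to the projector onto its image, so `Z` can be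
moved inside past the projector. -/
theorem discreteRandSVD_eq (A : H₁ →L[ℝ] H₂) {m n r : ℕ} (w : Fin n → H₁) {z : Fin m → H₂}
    (hz : Orthonormal ℝ z) (Yn : Fin r → H₂) :
    discreteRandSVD A w z Yn = randSVD (compression A w z) (fun j => frameProj z (Yn j)) := by
  have hmap : (colSpan fun j => (quasiMatrix z).adjoint (Yn j)).map
      (quasiMatrixIsometry hz).toLinearMap = colSpan fun j => frameProj z (Yn j) := by
    rw [← LinearMap.range_comp]
    congr 1
    refine LinearMap.ext fun ξ => ?_
    change quasiMatrix z (quasiMatrix _ ξ) = quasiMatrix _ ξ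
    rw [quasiMatrix_apply (fun j => (quasiMatrix z).adjoint (Yn j)),
      quasiMatrix_apply (fun j => frameProj z (Yn j)), map_sum]
    simp only [map_smul]
    rfl
  ext x
  have h := (quasiMatrixIsometry hz).map_starProjection
    (colSpan fun j => (quasiMatrix z).adjoint (Yn j))
    (discretization A w z ((quasiMatrix w).adjoint x))
  simp only [hmap] at h
  exact h

theorem measurable_sampleError [SeparableSpace H₁] [SeparableSpace H₂] [MeasurableSpace H₂]
    [BorelSpace H₂] (A : H₁ →L[ℝ] H₂) {m n : ℕ} (r : ℕ) (w : Fin n → H₁) {z : Fin m → H₂}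
    (hz : Orthonormal ℝ z) : Measurable fun S : Fin r → H₂ × H₂ => sampleError A w z S := by
  refine measurable_hsNorm fun x y => ?_
  simp_rw [discreteRandSVD_eq A w hz, sub_apply, inner_sub_right]
  refine Measurable.sub ?_ ?_
  · exact measurable_inner_starProjection (by fun_prop) _ _
  · exact measurable_inner_starProjection (by fun_prop) _ _

end
end RandSVD

/-! ### Perturbation of orthogonal projectors -/

namespace RandSVD

section
variable {F : Type*} [NormedAddCommGroup F] [InnerProductSpace ℝ F]

/-- If every vector of `M'` is close to `M`, then the projector onto `M'` is small on `Mᗮ`. -/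
theorem norm_starProjection_sub_le {M M' : Submodule ℝ F} [M.HasOrthogonalProjection]
    [M'.HasOrthogonalProjection] {δ : ℝ} (hδ : 0 ≤ δ)
    (h : ∀ x ∈ M', ‖x - M.starProjection x‖ ≤ δ * ‖x‖)
    (x : F) : ‖M'.starProjection (x - M.starProjection x)‖ ≤ δ * ‖x‖ := by
  set u := x - M.starProjection x
  set v := M'.starProjection u with hv
  have hvM : v ∈ M' := Submodule.starProjection_apply_mem _ _
  rcases eq_or_ne v 0 with h0 | h0
  · rw [h0, norm_zero]
    positivity
  -- Duality: `P_{M'}(1 - P_M)` is the adjoint of `(1 - P_M)P_{M'}`, which `h` controls.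
  have h1 : ‖v‖ * ‖v‖ ≤ ‖x‖ * (δ * ‖v‖) := by
    calc ‖v‖ * ‖v‖ = ⟪u, v⟫_ℝ := by
          rw [← real_inner_self_eq_norm_mul_norm]
          nth_rw 1 [hv]
          rw [Submodule.inner_starProjection_left_eq_right, Submodule.starProjection_eq_self_iff.2 hvM]
      _ = ⟪x, v - M.starProjection v⟫_ℝ := by
          rw [inner_sub_left, inner_sub_right, Submodule.inner_starProjection_left_eq_right]
      _ ≤ ‖x‖ * ‖v - M.starProjection v‖ := real_inner_le_norm _ _
      _ ≤ _ := by gcongr; exact h v hvM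
  have := norm_pos_iff.2 h0
  nlinarith

/-- Perturbation of an orthogonal projector, one-sided: it is enough that `M` is close to `M'`, if
the dimension of `M'` is not larger than that of `M`. -/
theorem norm_starProjection_sub_starProjection_le {M M' : Submodule ℝ F} [FiniteDimensional ℝ M]
    [FiniteDimensional ℝ M'] (hdim : Module.finrank ℝ M' ≤ Module.finrank ℝ M) {δ : ℝ} (hδ : 0 ≤ δ)
    (h : ∀ x ∈ M, ‖x - M'.starProjection x‖ ≤ δ * ‖x‖) (x : F) :
    ‖M.starProjection x - M'.starProjection x‖ ≤ 4 * δ * ‖x‖ := by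
  have hM := M.norm_starProjection_apply_le x
  -- For `δ ≥ 1/2` the trivial bound `2‖x‖` suffices; this case fixes the constant 4, the other one
  -- gives 3. For `δ < 1/2` the projector onto `M'` is injective on `M`, hence bijective onto `M'`
  -- by dimension, and closeness becomes two-sided.
  rcases le_or_gt (1 / 2) δ with h2 | h2
  · have := M'.norm_starProjection_apply_le x
    have := norm_sub_le (M.starProjection x) (M'.starProjection x)
    nlinarith [norm_nonneg x]
  let f : M →ₗ[ℝ] M' := (M'.orthogonalProjectionOnto : F →ₗ[ℝ] M') ∘ₗ M.subtype
  have hf (y : M) : (f y : F) = M'.starProjection y := rfl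
  have hle (y : M) : ‖(y : F)‖ ≤ 2 * ‖(f y : F)‖ := by
    have := h y y.2
    have := norm_sub_norm_le (y : F) (M'.starProjection y)
    rw [hf]
    nlinarith [norm_nonneg (y : F)]
  have hinj : Function.Injective f := by
    rw [← LinearMap.ker_eq_bot, LinearMap.ker_eq_bot']
    intro y hy
    have := hle y
    rw [hy] at this
    simpa using this
  have hsurj : Function.Surjective f :=
    (LinearMap.injective_iff_surjective_of_finrank_eq_finrank
      (le_antisymm (LinearMap.finrank_le_finrank_of_injective hinj) hdim)).1 hinj
  -- The preimage `a ∈ M` of `y` is a competitor for the distance of `y` to `M`; the factor 2 is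
  -- `‖a‖ ≤ 2‖y‖`.
  have h' : ∀ y ∈ M', ‖y - M.starProjection y‖ ≤ 2 * δ * ‖y‖ := by
    intro y hy
    obtain ⟨a, ha⟩ := hsurj ⟨y, hy⟩
    have hay : M'.starProjection a = y := by rw [← hf, ha]
    have h3 := norm_sub_starProjection_le M y a.2
    have h4 := h a a.2
    have h5 := hle a
    rw [ha] at h5
    rw [hay, norm_sub_rev] at h4
    simp only at h5
    nlinarith
  have h6 := h _ (Submodule.starProjection_apply_mem M x)
  have h7 := norm_starProjection_sub_le (by positivity) h' x
  calc ‖M.starProjection x - M'.starProjection x‖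
      = ‖(M.starProjection x - M'.starProjection (M.starProjection x))
          - M'.starProjection (x - M.starProjection x)‖ := by rw [map_sub]; congr 1; abel
    _ ≤ _ := norm_sub_le _ _
    _ ≤ δ * ‖x‖ + 2 * δ * ‖x‖ := add_le_add (h6.trans (by gcongr)) h7
    _ ≤ _ := by nlinarith [mul_nonneg hδ (norm_nonneg x)]

theorem finrank_colSpan_le {r : ℕ} (Y : Fin r → F) : Module.finrank ℝ (colSpan Y) ≤ r := by
  simpa using LinearMap.finrank_range_le (quasiMatrix Y).toLinearMap

/-- A coordinate of a vector in the span of `Y` is at most its norm, divided by the distance of the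
column to the span of the others. -/
theorem abs_mul_residual_le {s : ℕ} (Y : Fin (s + 1) → F) (j : Fin (s + 1))
    (ξ : EuclideanSpace ℝ (Fin (s + 1))) :
    |ξ j| * (residual (Y j) (fun i => Y (j.succAbove i))).toReal ≤ ‖quasiMatrix Y ξ‖ := by
  set V := colSpan fun i => Y (j.succAbove i)
  have hv : (∑ i : Fin s, ξ (j.succAbove i) • Y (j.succAbove i)) ∈ V :=
    Submodule.sum_mem _ fun i _ => V.smul_mem _ (mem_colSpan (fun i => Y (j.succAbove i)) i)
  calc _ = ‖quasiMatrix Y ξ - V.starProjection (quasiMatrix Y ξ)‖ := by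
        rw [quasiMatrix_apply, Fin.sum_univ_succAbove _ j, map_add, map_smul,
          Submodule.starProjection_eq_self_iff.2 hv, add_sub_add_right_eq_sub, ← smul_sub,
          norm_smul, residual, toReal_enorm, Real.norm_eq_abs]
    _ ≤ ‖quasiMatrix Y ξ - 0‖ := norm_sub_starProjection_le V _ V.zero_mem
    _ = _ := by rw [sub_zero]

/-- The relative perturbation of the columns of a quasi-matrix, which bounds the perturbation of the
projector onto its range. -/
noncomputable def perturbation {s : ℕ} (Y Y' : Fin (s + 1) → F) : ℝ≥0∞ :=
  ∑ j, ‖Y j - Y' j‖ₑ * (residual (Y j) (fun i => Y (j.succAbove i)))⁻¹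

/-- Nonzero residuals make the columns of `Y` independent, so its span has the maximal dimension `s
+ 1` and the one-sided perturbation bound applies. -/
theorem enorm_starProjection_sub_le {s : ℕ} (Y Y' : Fin (s + 1) → F)
    (hY : ∀ j, residual (Y j) (fun i => Y (j.succAbove i)) ≠ 0) :
    ‖(colSpan Y).starProjection - (colSpan Y').starProjection‖ₑ ≤ 4 * perturbation Y Y' := by
  set d : Fin (s + 1) → ℝ := fun j => (residual (Y j) (fun i => Y (j.succAbove i))).toReal
  have hd (j) : 0 < d j := ENNReal.toReal_pos (hY j) enorm_ne_top
  set δ : ℝ := ∑ j, ‖Y j - Y' j‖ * (d j)⁻¹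
  have hδ0 : 0 ≤ δ := Finset.sum_nonneg fun j _ => mul_nonneg (norm_nonneg _) (inv_nonneg.2 (hd j).le)
  have hinj : Function.Injective (quasiMatrix Y).toLinearMap := by
    rw [← LinearMap.ker_eq_bot, LinearMap.ker_eq_bot']
    intro ξ hξ
    ext j
    have h := abs_mul_residual_le Y j ξ
    rw [show quasiMatrix Y ξ = 0 from hξ, norm_zero] at h
    have h2 := hd j
    simp only [d] at h2
    have h3 : |ξ j| ≤ 0 := by
      by_contra! h3
      nlinarith
    simpa using h3
  have hdim : Module.finrank ℝ (colSpan Y') ≤ Module.finrank ℝ (colSpan Y) := by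
    rw [LinearMap.finrank_range_of_inj hinj]
    simpa using finrank_colSpan_le Y'
  have hδ : ENNReal.ofReal δ = perturbation Y Y' := by
    rw [perturbation, ENNReal.ofReal_sum_of_nonneg
      fun j _ => mul_nonneg (norm_nonneg _) (inv_nonneg.2 (hd j).le)]
    refine Finset.sum_congr rfl fun j _ => ?_
    rw [ENNReal.ofReal_mul (norm_nonneg _), ofReal_norm, ENNReal.ofReal_inv_of_pos (hd j)]
    congr 2
    exact ENNReal.ofReal_toReal enorm_ne_top
  -- The competitor for `x = Y ξ` is `Y' ξ`, with the same coefficients.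
  have hmain : ∀ x ∈ colSpan Y, ‖x - (colSpan Y').starProjection x‖ ≤ δ * ‖x‖ := by
    rintro _ ⟨ξ, rfl⟩
    refine (norm_sub_starProjection_le (colSpan Y') _ ⟨ξ, rfl⟩).trans ?_
    simp only [ContinuousLinearMap.coe_coe]
    rw [quasiMatrix_apply, quasiMatrix_apply Y', ← Finset.sum_sub_distrib, Finset.sum_mul]
    refine (norm_sum_le _ _).trans (Finset.sum_le_sum fun j _ => ?_)
    rw [← smul_sub, norm_smul, Real.norm_eq_abs, mul_comm, mul_assoc]
    gcongr
    rw [inv_mul_eq_div, le_div_iff₀ (hd j), ← quasiMatrix_apply]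
    exact abs_mul_residual_le Y j ξ
  rw [← hδ, ← ofReal_norm, show (4 : ℝ≥0∞) = ENNReal.ofReal 4 by simp,
    ← ENNReal.ofReal_mul (by norm_num)]
  refine ENNReal.ofReal_le_ofReal (ContinuousLinearMap.opNorm_le_bound _ (by positivity) fun x => ?_)
  exact norm_starProjection_sub_starProjection_le hdim hδ0 hmain x

end

section
variable {H₁ H₂ : Type*}
  [NormedAddCommGroup H₁] [InnerProductSpace ℝ H₁] [CompleteSpace H₁]
  [NormedAddCommGroup H₂] [InnerProductSpace ℝ H₂] [CompleteSpace H₂]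

/-- In `P A - P' A' = P'(A - A') + (P - P')A` the projector `P'` is a contraction, and the projector
difference meets only the fixed operator `A`. -/
theorem sampleError_le (A : H₁ →L[ℝ] H₂) {m n r : ℕ} (w : Fin n → H₁) {z : Fin m → H₂}
    (hz : Orthonormal ℝ z) (S : Fin r → H₂ × H₂) :
    sampleError A w z S ≤ hsNorm (A - compression A w z) +
      ‖(colSpan fun j => (S j).2).starProjection -
        (colSpan fun j => frameProj z (S j).1).starProjection‖ₑ * hsNorm A := by
  rw [sampleError, discreteRandSVD_eq A w hz]
  have h : randSVD A (fun j => (S j).2) -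
        randSVD (compression A w z) (fun j => frameProj z (S j).1) =
      (colSpan fun j => frameProj z (S j).1).starProjection ∘L (A - compression A w z) +
      ((colSpan fun j => (S j).2).starProjection -
        (colSpan fun j => frameProj z (S j).1).starProjection) ∘L A := by
    ext x
    simp only [randSVD, sub_apply, add_apply,
      ContinuousLinearMap.comp_apply, map_sub]
    abel
  rw [h]
  refine (hsNorm_add_le _ _).trans (add_le_add ?_ (hsNorm_comp_le _ _))
  refine (hsNorm_comp_le _ _).trans (mul_le_of_le_one_left' ?_)
  rw [← ofReal_norm]
  exact ENNReal.ofReal_le_one.2 (Submodule.starProjection_norm_le _)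

end
end RandSVD

/-! ### Gaussian measures and their coupling -/

namespace RandSVD

section
variable {E F G : Type*} [NormedAddCommGroup E] [InnerProductSpace ℝ E] [CompleteSpace E]
  [NormedAddCommGroup F] [InnerProductSpace ℝ F] [CompleteSpace F]
  [NormedAddCommGroup G] [InnerProductSpace ℝ G] [CompleteSpace G]

theorem hsNorm_adjoint (T : E →L[ℝ] F) : hsNorm T.adjoint = hsNorm T := by
  rw [hsNorm, hsNorm, tsum_enorm_sq_adjoint (basis E) (basis F) T]

theorem hsNorm_comp_le' (T : F →L[ℝ] G) (C : E →L[ℝ] F) : hsNorm (T ∘L C) ≤ ‖C‖ₑ * hsNorm T := by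
  rw [← hsNorm_adjoint, ContinuousLinearMap.adjoint_comp, ← hsNorm_adjoint T]
  refine (hsNorm_comp_le _ _).trans_eq ?_
  congr 1
  rw [← ofReal_norm, ← ofReal_norm, LinearIsometryEquiv.norm_map]

theorem frameProj_adjoint {n : ℕ} (w : Fin n → E) : (frameProj w).adjoint = frameProj w := by
  rw [ContinuousLinearMap.adjoint_comp, ContinuousLinearMap.adjoint_adjoint]

theorem quasiMatrix_adjoint_apply_self {n : ℕ} {w : Fin n → E} (hw : Orthonormal ℝ w)
    (ξ : EuclideanSpace ℝ (Fin n)) : (quasiMatrix w).adjoint (quasiMatrix w ξ) = ξ :=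
  ext_inner_right ℝ fun ζ => by
    rw [ContinuousLinearMap.adjoint_inner_left]
    exact (quasiMatrixIsometry hw).inner_map_map ξ ζ

theorem frameProj_comp_self {n : ℕ} {w : Fin n → E} (hw : Orthonormal ℝ w) :
    frameProj w ∘L frameProj w = frameProj w := by
  ext x
  simp only [ContinuousLinearMap.comp_apply, quasiMatrix_adjoint_apply_self hw]

end

section
variable {E F G : Type*} [NormedAddCommGroup E] [InnerProductSpace ℝ E] [CompleteSpace E]
  [NormedAddCommGroup F] [InnerProductSpace ℝ F] [CompleteSpace F] [SeparableSpace F]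
  [MeasurableSpace F] [BorelSpace F]
  [NormedAddCommGroup G] [InnerProductSpace ℝ G] [CompleteSpace G] [SeparableSpace G]
  [MeasurableSpace G] [BorelSpace G]

theorem IsCenteredGaussian.memLp_two {μ : Measure F} {T : F →L[ℝ] F}
    (h : IsCenteredGaussian μ T) : MemLp id 2 μ := by
  have : SecondCountableTopology F := UniformSpace.secondCountable_of_separable F
  have := h.isGaussian
  exact IsGaussian.memLp_two_id

theorem IsCenteredGaussian.integral_inner_mul_inner {μ : Measure F} {T : F →L[ℝ] F}
    (h : IsCenteredGaussian μ T) (x y : F) : ∫ u, ⟪x, u⟫_ℝ * ⟪y, u⟫_ℝ ∂μ = ⟪T x, y⟫_ℝ := by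
  rw [← h.covariance_eq, covarianceOperator_inner h.memLp_two]

/-- The image of a centered Gaussian measure under a bounded operator. -/
theorem IsCenteredGaussian.map {μ : Measure F} {B : E →L[ℝ] F}
    (h : IsCenteredGaussian μ (B ∘L B.adjoint)) (L : F →L[ℝ] G) :
    IsCenteredGaussian (μ.map L) ((L ∘L B) ∘L (L ∘L B).adjoint) := by
  have : SecondCountableTopology F := UniformSpace.secondCountable_of_separable F
  have : SecondCountableTopology G := UniformSpace.secondCountable_of_separable G
  have := h.isGaussian
  have hG : IsGaussian (μ.map L) := inferInstance
  refine ⟨hG, ?_, ?_⟩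
  · have := L.integral_id_map (μ := μ) (h.memLp_two.integrable (by simp))
    rw [this]
    change L (∫ y, y ∂μ) = 0
    rw [h.mean_eq_zero, map_zero]
  · ext x
    refine ext_inner_right ℝ fun y => ?_
    rw [covarianceOperator_inner IsGaussian.memLp_two_id, integral_map (by fun_prop) (by fun_prop)]
    simp_rw [← ContinuousLinearMap.adjoint_inner_left]
    rw [h.integral_inner_mul_inner, ContinuousLinearMap.adjoint_comp]
    simp only [ContinuousLinearMap.comp_apply, ContinuousLinearMap.adjoint_inner_right]

/-- The coordinate along a basis vector `e` has variance `‖B* e‖²`; summing over the basis gives the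
Hilbert–Schmidt norm of `B*`, which is that of `B`. -/
theorem IsCenteredGaussian.lintegral_enorm_sq {μ : Measure F} {B : E →L[ℝ] F}
    (h : IsCenteredGaussian μ (B ∘L B.adjoint)) : ∫⁻ y, ‖y‖ₑ ^ 2 ∂μ = hsNorm B ^ 2 := by
  have := countable_hilbertBasis (basis F)
  have h1 (x : F) : ∫⁻ y, ‖⟪x, y⟫_ℝ‖ₑ ^ 2 ∂μ = ‖B.adjoint x‖ₑ ^ 2 := by
    have hi : Integrable (fun y => ⟪x, y⟫_ℝ * ⟪x, y⟫_ℝ) μ :=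
      (h.memLp_two.const_inner x).integrable_mul (h.memLp_two.const_inner x)
    have h2 := ofReal_integral_eq_lintegral_ofReal hi (.of_forall fun y => mul_self_nonneg _)
    rw [h.integral_inner_mul_inner, ContinuousLinearMap.comp_apply,
      ← ContinuousLinearMap.adjoint_inner_right, real_inner_self_eq_norm_sq,
      ENNReal.ofReal_pow (norm_nonneg _), ofReal_norm] at h2
    rw [h2]
    congr! 2 with y
    rw [← ofReal_norm, ← ENNReal.ofReal_pow (norm_nonneg _), Real.norm_eq_abs, sq_abs, sq]
  simp_rw [← tsum_enorm_inner_sq (basis F)]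
  rw [lintegral_tsum fun j => by fun_prop]
  simp_rw [h1]
  rw [← hsNorm_adjoint, hsNorm_sq]

end

section
variable {H₁ H₂ : Type*}
  [NormedAddCommGroup H₁] [InnerProductSpace ℝ H₁] [CompleteSpace H₁]
  [NormedAddCommGroup H₂] [InnerProductSpace ℝ H₂] [CompleteSpace H₂] [SeparableSpace H₂]
  [MeasurableSpace H₂] [BorelSpace H₂]

/-- Two operators applied to the same Gaussian noise give a coupling of `N(0, B B*)` and `N(0, A A*)`
for which linear functions of the pair are again Gaussian. -/
theorem exists_linear_coupling {A B : H₁ →L[ℝ] H₂} (hA : IsHilbertSchmidt A)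
    (hB : IsHilbertSchmidt B) :
    ∃ γ : Measure (H₂ × H₂), ∀ L : H₂ × H₂ →L[ℝ] H₂,
      IsCenteredGaussian (γ.map L) ((L ∘L B.prod A) ∘L (L ∘L B.prod A).adjoint) := by
  have : SecondCountableTopology H₂ := UniformSpace.secondCountable_of_separable H₂
  -- The product type carries the sup norm, so the Gaussian measure is built on the Hilbert direct
  -- sum and transported back.
  let e := WithLp.prodContinuousLinearEquiv 2 ℝ H₂ H₂
  let T : H₁ →L[ℝ] WithLp 2 (H₂ × H₂) := (e.symm : H₂ × H₂ →L[ℝ] WithLp 2 (H₂ × H₂)) ∘L B.prod A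
  have hT : IsHilbertSchmidt T := by
    have h : T = ((e.symm : H₂ × H₂ →L[ℝ] WithLp 2 (H₂ × H₂)) ∘L .inl ℝ H₂ H₂) ∘L B +
        ((e.symm : H₂ × H₂ →L[ℝ] WithLp 2 (H₂ × H₂)) ∘L .inr ℝ H₂ H₂) ∘L A := by
      ext x
      simp [T, e, ← WithLp.toLp_add]
    rw [IsHilbertSchmidt, h]
    refine (hsNorm_add_le _ _).trans_lt (ENNReal.add_lt_top.2 ⟨?_, ?_⟩)
    · exact (hsNorm_comp_le _ _).trans_lt (ENNReal.mul_lt_top enorm_lt_top hB)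
    · exact (hsNorm_comp_le _ _).trans_lt (ENNReal.mul_lt_top enorm_lt_top hA)
  obtain ⟨ν, hν⟩ := exists_isCenteredGaussian hT
  refine ⟨ν.map e, fun L => ?_⟩
  have h := hν.map (L ∘L (e : WithLp 2 (H₂ × H₂) →L[ℝ] H₂ × H₂))
  have hL : (L ∘L (e : WithLp 2 (H₂ × H₂) →L[ℝ] H₂ × H₂)) ∘L T = L ∘L B.prod A := by
    ext x
    simp [T]
  rw [hL] at h
  rw [Measure.map_map L.continuous.measurable e.continuous.measurable]
  exact h

/-- A coupling for which the expected squared distance of the columns is that of the operators. -/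
theorem exists_coupling {A : H₁ →L[ℝ] H₂} (hA : IsHilbertSchmidt A) {m n : ℕ} {w : Fin n → H₁}
    (hw : Orthonormal ℝ w) (z : Fin m → H₂) :
    ∃ γ ∈ couplings (discreteSketchMeasure A w) (sketchMeasure A), IsProbabilityMeasure γ ∧
      ∫⁻ q, ‖q.2 - frameProj z q.1‖ₑ ^ 2 ∂γ = hsNorm (A - compression A w z) ^ 2 := by
  have : SecondCountableTopology H₂ := UniformSpace.secondCountable_of_separable H₂
  -- `A W W*` acts on the same space as `A`, so both can share the noise; its covariance is still `A
  -- W W* A*` because `W W*` is a projector.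
  have hB : IsHilbertSchmidt (A ∘L frameProj w) :=
    (hsNorm_comp_le' _ _).trans_lt (ENNReal.mul_lt_top enorm_lt_top hA)
  obtain ⟨γ, hγ⟩ := exists_linear_coupling hA hB
  have hfst := hγ (.fst ℝ H₂ H₂)
  have hsnd := hγ (.snd ℝ H₂ H₂)
  -- On the pair `(A W W*, A)` this functional yields `A - Z Z* A W W*`, the compression error.
  have hdiff := hγ (.snd ℝ H₂ H₂ - frameProj z ∘L .fst ℝ H₂ H₂)
  rw [ContinuousLinearMap.fst_comp_prod] at hfst
  rw [ContinuousLinearMap.snd_comp_prod] at hsnd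
  refine ⟨γ, ⟨?_, ?_⟩, ?_, ?_⟩
  · refine hfst.unique ?_
    convert isCenteredGaussian_discreteSketchMeasure A w using 1
    rw [ContinuousLinearMap.adjoint_comp, frameProj_adjoint, ContinuousLinearMap.comp_assoc,
      ← ContinuousLinearMap.comp_assoc (frameProj w), frameProj_comp_self hw]
    rfl
  · exact hsnd.unique (isCenteredGaussian_sketchMeasure hA)
  · have := hfst.isGaussian
    have h1 : (γ.map (ContinuousLinearMap.fst ℝ H₂ H₂)) Set.univ = 1 := measure_univ
    rw [Measure.map_apply (by fun_prop) .univ, Set.preimage_univ] at h1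
    exact ⟨h1⟩
  · have h := hdiff.lintegral_enorm_sq
    rw [lintegral_map (by fun_prop) (by fun_prop)] at h
    exact h

end
end RandSVD

/-! ### Inverse moments of the residual -/

namespace RandSVD

/-- The density is at most 1, as `2π ≥ 1`. Near the origin, negative moments then compare with
Lebesgue integrals. -/
theorem gaussianReal_le_volume : gaussianReal 0 1 ≤ volume := by
  rw [gaussianReal_of_var_ne_zero _ one_ne_zero]
  refine (withDensity_mono (.of_forall fun x => ?_)).trans_eq withDensity_one
  rw [gaussianPDF, Pi.one_apply, gaussianPDFReal]
  refine ENNReal.ofReal_le_one.2 (mul_le_one₀ (inv_le_one_of_one_le₀ ?_) (Real.exp_pos _).le ?_)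
  · rw [Real.one_le_sqrt]
    simp only [NNReal.coe_one, mul_one]
    linarith [Real.pi_gt_three]
  · rw [Real.exp_le_one_iff]
    simp only [sub_zero, NNReal.coe_one, mul_one]
    have := sq_nonneg x
    linarith

theorem setLIntegral_enorm_rpow_lt_top {r : ℝ} (hr : -1 < r) :
    ∫⁻ x in Set.Ioc (-1 : ℝ) 1, ‖x‖ₑ ^ r < ∞ := by
  have h0 : IntervalIntegrable (fun x : ℝ => |x| ^ r) volume 0 1 := by
    refine (intervalIntegral.intervalIntegrable_rpow' hr).congr fun x hx => ?_
    rw [Set.uIoc_of_le zero_le_one] at hx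
    simp only [abs_of_pos hx.1]
  have h1 : IntervalIntegrable (fun x : ℝ => |x| ^ r) volume (-1) 1 := by
    refine IntervalIntegrable.trans (b := 0) ?_ h0
    rw [IntervalIntegrable.iff_comp_neg]
    simpa using h0.symm
  rw [intervalIntegrable_iff_integrableOn_Ioc_of_le (by norm_num)] at h1
  refine lt_of_le_of_lt (lintegral_mono_ae ?_) h1.2
  -- At the origin the two powers differ for negative `r`: the extended one is `∞`, the real one
  -- `0`.
  filter_upwards [ae_restrict_of_ae (Measure.ae_ne volume (0 : ℝ))] with x hx
  rw [← ofReal_norm (|x| ^ r), Real.norm_of_nonneg (by positivity),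
    ← ENNReal.ofReal_rpow_of_pos (abs_pos.2 hx), ← Real.norm_eq_abs, ofReal_norm]

/-- The negative moments of order larger than `-1` of the standard normal law are finite. -/
theorem lintegral_gaussianReal_enorm_rpow_lt_top {r : ℝ} (hr : -1 < r) (hr0 : r < 0) :
    ∫⁻ x, ‖x‖ₑ ^ r ∂gaussianReal 0 1 < ∞ := by
  rw [← lintegral_add_compl _ (measurableSet_Ioc : MeasurableSet (Set.Ioc (-1 : ℝ) 1))]
  refine ENNReal.add_lt_top.2 ⟨?_, ?_⟩
  · exact (lintegral_mono' (Measure.restrict_mono le_rfl gaussianReal_le_volume) le_rfl).trans_lt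
      (setLIntegral_enorm_rpow_lt_top hr)
  · refine lt_of_le_of_lt (setLIntegral_mono' measurableSet_Ioc.compl (g := fun _ => 1)
      fun x hx => ?_) (by simp)
    refine ENNReal.rpow_le_one_of_one_le_of_neg ?_ hr0
    rw [← ofReal_norm, ENNReal.one_le_ofReal, Real.norm_eq_abs, le_abs']
    by_contra! h
    exact hx ⟨h.1, h.2.le⟩

/-- The inverse second moment of three independent standard normal variables. -/
theorem lintegral_inv_sum_sq_le {Ω : Type*} [MeasurableSpace Ω] {P : Measure Ω}
    {X : Fin 3 → Ω → ℝ} (hX : ∀ i, Measurable (X i)) (hI : iIndepFun X P)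
    (hlaw : ∀ i, P.map (X i) = gaussianReal 0 1) :
    ∫⁻ ω, (∑ i, ‖X i ω‖ₑ ^ 2)⁻¹ ∂P ≤ (∫⁻ x, ‖x‖ₑ ^ (-2 / 3 : ℝ) ∂gaussianReal 0 1) ^ 3 := by
  -- Split `s⁻¹` into three factors `s^(-1/3)` and use `s ≥ X_i²` in each. Three variables make the
  -- exponent `-2/3`, above the critical `-1` that two would give.
  have hpt (ω : Ω) : (∑ i, ‖X i ω‖ₑ ^ 2)⁻¹ ≤ ∏ i, ‖X i ω‖ₑ ^ (-2 / 3 : ℝ) := by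
    set s := ∑ i, ‖X i ω‖ₑ ^ 2
    have hs : s⁻¹ = ∏ _i : Fin 3, s ^ (-1 / 3 : ℝ) := by
      rw [Finset.prod_const, Finset.card_univ, Fintype.card_fin, ← ENNReal.rpow_natCast,
        ← ENNReal.rpow_mul, ← ENNReal.rpow_neg_one]
      norm_num
    rw [hs]
    refine Finset.prod_le_prod' fun i _ => ?_
    have h : ‖X i ω‖ₑ ^ (-2 / 3 : ℝ) = (‖X i ω‖ₑ ^ 2) ^ (-1 / 3 : ℝ) := by
      rw [← ENNReal.rpow_natCast, ← ENNReal.rpow_mul]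
      norm_num
    rw [h, neg_div, ENNReal.rpow_neg, ENNReal.rpow_neg, ENNReal.inv_le_inv]
    gcongr
    exact Finset.single_le_sum (f := fun i => ‖X i ω‖ₑ ^ 2) (fun _ _ => zero_le) (Finset.mem_univ i)
  refine (lintegral_mono hpt).trans_eq ?_
  have hm : Measurable fun x : ℝ => ‖x‖ₑ ^ (-2 / 3 : ℝ) := by fun_prop
  rw [lintegral_prod_eq_prod_lintegral_of_indepFun Finset.univ
    (fun i ω => ‖X i ω‖ₑ ^ (-2 / 3 : ℝ)) (hI.comp (fun _ x => ‖x‖ₑ ^ (-2 / 3 : ℝ)) fun _ => hm)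
    fun i => hm.comp (hX i)]
  have h (i : Fin 3) : ∫⁻ ω, ‖X i ω‖ₑ ^ (-2 / 3 : ℝ) ∂P =
      ∫⁻ x, ‖x‖ₑ ^ (-2 / 3 : ℝ) ∂gaussianReal 0 1 := by
    rw [← hlaw i, lintegral_map hm (hX i)]
  simp [h]

section
variable {H₁ H₂ : Type*}
  [NormedAddCommGroup H₁] [InnerProductSpace ℝ H₁] [CompleteSpace H₁]
  [NormedAddCommGroup H₂] [InnerProductSpace ℝ H₂] [CompleteSpace H₂]

/-- For an operator of rank at least `s + 3`, any `s` vectors are orthogonal to three vectors of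
bounded norm with orthonormal images under the adjoint. -/
theorem exists_orthonormal_adjoint {s : ℕ} {A : H₁ →L[ℝ] H₂}
    (hrank : ((s + 3 : ℕ) : Cardinal) ≤ LinearMap.rank (A : H₁ →ₗ[ℝ] H₂)) :
    ∃ κ : ℝ≥0, 0 < κ ∧ ∀ v : Fin s → H₂, ∃ u : Fin 3 → H₂,
      (∀ i j, ⟪u i, v j⟫_ℝ = 0) ∧ Orthonormal ℝ (fun i => A.adjoint (u i)) ∧ ∀ i, ‖u i‖ ≤ κ := by
  obtain ⟨y, hy⟩ := Module.le_rank_iff.1 hrank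
  set U : Submodule ℝ H₂ := Submodule.span ℝ (Set.range fun i => (y i : H₂))
  have hUfin : Module.finrank ℝ U = s + 3 := by
    have hy' : LinearIndependent ℝ fun i => (y i : H₂) :=
      hy.map' (Submodule.subtype _) (Submodule.ker_subtype _)
    simpa using finrank_span_eq_card hy'
  have : FiniteDimensional ℝ U := FiniteDimensional.span_of_finite ℝ (Set.finite_range _)
  have hUr : U ≤ LinearMap.range (A : H₁ →ₗ[ℝ] H₂) := by
    rw [Submodule.span_le]
    rintro _ ⟨i, rfl⟩
    exact (y i).2
  let T : U →ₗ[ℝ] H₁ := (A.adjoint : H₂ →ₗ[ℝ] H₁) ∘ₗ U.subtype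
  -- `A*` is injective on `U`, since its kernel is orthogonal to the range of `A`.
  have hT : LinearMap.ker T = ⊥ := by
    rw [LinearMap.ker_eq_bot']
    intro u hu
    obtain ⟨x, hx⟩ := hUr u.2
    have h0 : ⟪(u : H₂), u⟫_ℝ = 0 := by
      nth_rw 2 [← hx]
      rw [ContinuousLinearMap.coe_coe, ← ContinuousLinearMap.adjoint_inner_left]
      change ⟪T u, x⟫_ℝ = 0
      rw [hu, inner_zero_left]
    exact Subtype.ext (inner_self_eq_zero.1 h0)
  -- `κ` depends only on `U`, chosen before `v`; hence it is uniform in `v`.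
  obtain ⟨κ, hκ, hanti⟩ := T.exists_antilipschitzWith hT
  refine ⟨κ, hκ, fun v => ?_⟩
  let φ : U →ₗ[ℝ] (Fin s → ℝ) := LinearMap.pi fun j => (innerSL ℝ (v j) : H₂ →ₗ[ℝ] ℝ) ∘ₗ U.subtype
  let N := LinearMap.ker φ
  have hN : 3 ≤ Module.finrank ℝ N := by
    change 3 ≤ Module.finrank ℝ (LinearMap.ker φ)
    have h1 := φ.finrank_range_add_finrank_ker
    have h2 : Module.finrank ℝ (LinearMap.range φ) ≤ s := by
      simpa using Submodule.finrank_le (LinearMap.range φ)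
    rw [hUfin] at h1
    omega
  -- Orthonormality is arranged in the image under `A*`, where inner products are the covariances of
  -- the Gaussian coordinates.
  let M := N.map T
  have hM : 3 ≤ Module.finrank ℝ M := by
    rwa [(Submodule.equivMapOfInjective T (LinearMap.ker_eq_bot.1 hT) N).finrank_eq.symm]
  let b := stdOrthonormalBasis ℝ M
  let c : Fin 3 → M := fun i => b (Fin.castLE hM i)
  have hc (i : Fin 3) : ∃ u ∈ N, T u = c i := (c i).2
  choose u huN hu using hc
  refine ⟨fun i => u i, fun i j => ?_, ?_, fun i => ?_⟩
  · rw [real_inner_comm]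
    exact congr_fun (LinearMap.mem_ker.1 (huN i)) j
  · have h1 : Orthonormal ℝ (fun i => (c i : H₁)) :=
      (b.orthonormal.comp _ (Fin.castLE_injective hM)).comp_linearIsometry M.subtypeₗᵢ
    convert h1 using 2 with i
    exact hu i
  · have h1 := hanti.le_mul_dist (u i) 0
    rw [map_zero, dist_zero_right, dist_zero_right, hu] at h1
    have h2 : ‖(c i : H₁)‖ = 1 := b.orthonormal.1 _
    rw [h2, mul_one] at h1
    exact h1

variable [SeparableSpace H₂] [MeasurableSpace H₂] [BorelSpace H₂]

/-- The coordinates `⟪u i, y⟫` are jointly Gaussian with identity covariance matrix, hence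
independent standard normals. -/
theorem lintegral_inv_sum_inner_sq_le {A : H₁ →L[ℝ] H₂} {μ : Measure H₂}
    (hμ : IsCenteredGaussian μ (A ∘L A.adjoint)) {u : Fin 3 → H₂}
    (hu : Orthonormal ℝ fun i => A.adjoint (u i)) :
    ∫⁻ y, (∑ i, ‖⟪u i, y⟫_ℝ‖ₑ ^ 2)⁻¹ ∂μ ≤
      (∫⁻ x, ‖x‖ₑ ^ (-2 / 3 : ℝ) ∂gaussianReal 0 1) ^ 3 := by
  have : SecondCountableTopology H₂ := UniformSpace.secondCountable_of_separable H₂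
  have := hμ.isGaussian
  have hcov (i j : Fin 3) : cov[fun y => ⟪u i, y⟫_ℝ, fun y => ⟪u j, y⟫_ℝ; μ] =
      ⟪A.adjoint (u i), A.adjoint (u j)⟫_ℝ := by
    rw [← covarianceBilin_apply_eq_cov hμ.memLp_two, hμ.covarianceBilin_apply,
      ContinuousLinearMap.comp_apply, ContinuousLinearMap.adjoint_inner_right]
  have hm (i : Fin 3) : Measurable fun y => ⟪u i, y⟫_ℝ := by fun_prop
  have hlaw : HasGaussianLaw (fun y i => ⟪u i, y⟫_ℝ) μ :=
    IsGaussian.hasGaussianLaw_id.map_fun (ContinuousLinearMap.pi fun i => innerSL ℝ (u i))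
  refine lintegral_inv_sum_sq_le hm (hlaw.iIndepFun_of_covariance_eq_zero fun i j hij => ?_) fun i => ?_
  · rw [hcov, hu.inner_eq_zero hij]
  · have h := IsGaussian.map_eq_gaussianReal (μ := μ) (innerSL ℝ (u i))
    have h1 : μ[innerSL ℝ (u i)] = 0 := by
      rw [ContinuousLinearMap.integral_comp_id_comm (hμ.memLp_two.integrable (by simp)),
        hμ.mean_eq_zero, map_zero]
    have h2 : Var[innerSL ℝ (u i); μ] = 1 := by
      rw [← covariance_self (by fun_prop)]
      exact (hcov i i).trans (by rw [real_inner_self_eq_norm_sq, hu.1 i, one_pow])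
    rw [h1, h2, Real.toNNReal_one] at h
    exact h

/-- The inverse squared distance of a Gaussian vector to the span of `s` fixed vectors has bounded
expectation, if the covariance operator has rank at least `s + 3`. -/
theorem exists_lintegral_inv_residual_sq_le {s : ℕ} {A : H₁ →L[ℝ] H₂}
    (hrank : ((s + 3 : ℕ) : Cardinal) ≤ LinearMap.rank (A : H₁ →ₗ[ℝ] H₂)) :
    ∃ K : ℝ≥0, ∀ μ : Measure H₂, IsCenteredGaussian μ (A ∘L A.adjoint) → ∀ v : Fin s → H₂,
      ∫⁻ y, (residual y v)⁻¹ ^ 2 ∂μ ≤ K := by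
  obtain ⟨κ, hκ, h⟩ := exists_orthonormal_adjoint hrank
  have hc : (∫⁻ x, ‖x‖ₑ ^ (-2 / 3 : ℝ) ∂gaussianReal 0 1) ^ 3 < ∞ :=
    ENNReal.pow_lt_top (lintegral_gaussianReal_enorm_rpow_lt_top (by norm_num) (by norm_num))
  lift (∫⁻ x, ‖x‖ₑ ^ (-2 / 3 : ℝ) ∂gaussianReal 0 1) ^ 3 to ℝ≥0 using hc.ne with c hc'
  refine ⟨3 * κ ^ 2 * c, fun μ hμ v => ?_⟩
  obtain ⟨u, huv, hu, huκ⟩ := h v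
  -- Each `u i` is orthogonal to the span of `v`, so it sees only the residual part of `y`.
  have hle (y : H₂) : ∑ i, ‖⟪u i, y⟫_ℝ‖ₑ ^ 2 ≤ (3 * κ ^ 2 : ℝ≥0) * residual y v ^ 2 := by
    have h1 (i : Fin 3) : ‖⟪u i, y⟫_ℝ‖ₑ ≤ κ * residual y v := by
      have h2 : ⟪u i, y⟫_ℝ = ⟪u i, y - (colSpan v).starProjection y⟫_ℝ := by
        obtain ⟨ξ, hξ⟩ : (colSpan v).starProjection y ∈ colSpan v :=
          Submodule.starProjection_apply_mem _ _
        rw [inner_sub_right, ← hξ, ContinuousLinearMap.coe_coe, quasiMatrix_apply, inner_sum]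
        simp [real_inner_smul_right, huv]
      rw [h2, residual, ← ofReal_norm, ← ofReal_norm, ← ENNReal.ofReal_coe_nnreal,
        ← ENNReal.ofReal_mul κ.coe_nonneg]
      refine ENNReal.ofReal_le_ofReal ((norm_inner_le_norm _ _).trans ?_)
      gcongr
      exact huκ i
    calc _ ≤ ∑ _i : Fin 3, (κ * residual y v) ^ 2 := by gcongr with i; exact h1 i
      _ = _ := by simp; ring
  have hk : ((3 * κ ^ 2 : ℝ≥0) : ℝ≥0∞) ≠ 0 := by
    rw [ENNReal.coe_ne_zero]
    positivity
  have hinv (y : H₂) : (residual y v)⁻¹ ^ 2 ≤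
      (3 * κ ^ 2 : ℝ≥0) * (∑ i, ‖⟪u i, y⟫_ℝ‖ₑ ^ 2)⁻¹ := by
    calc (residual y v)⁻¹ ^ 2
        = (3 * κ ^ 2 : ℝ≥0) * ((3 * κ ^ 2 : ℝ≥0) * residual y v ^ 2)⁻¹ := by
          rw [ENNReal.mul_inv (.inl hk) (.inl ENNReal.coe_ne_top), ← mul_assoc,
            ENNReal.mul_inv_cancel hk ENNReal.coe_ne_top, one_mul, ENNReal.inv_pow]
      _ ≤ _ := by gcongr; exact hle y
  refine (lintegral_mono hinv).trans ?_
  rw [lintegral_const_mul' _ _ ENNReal.coe_ne_top, ENNReal.coe_mul (3 * κ ^ 2) c]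
  gcongr
  rw [hc']
  exact lintegral_inv_sum_inner_sq_le hμ hu

end
end RandSVD

/-! ### Expected error under the coupling -/

namespace RandSVD

section
variable {H₁ H₂ : Type*}
  [NormedAddCommGroup H₁] [InnerProductSpace ℝ H₁] [CompleteSpace H₁]
  [NormedAddCommGroup H₂] [InnerProductSpace ℝ H₂] [CompleteSpace H₂] [SeparableSpace H₂]
  [MeasurableSpace H₂] [BorelSpace H₂]

/-- The inverse distance of the `j`-th column of `Y` to the span of the other columns. -/
noncomputable def inverseResidual {s : ℕ} (j : Fin (s + 1)) (S : Fin (s + 1) → H₂ × H₂) : ℝ≥0∞ :=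
  (residual (S j).2 (fun i => (S (j.succAbove i)).2))⁻¹

omit [CompleteSpace H₂] in
theorem measurable_inverseResidual {s : ℕ} (j : Fin (s + 1)) :
    Measurable (inverseResidual (H₂ := H₂) j) :=
  ((measurable_residual s).comp (f := fun S : Fin (s + 1) → H₂ × H₂ =>
    ((S j).2, fun i => (S (j.succAbove i)).2)) (by fun_prop)).inv

/-- By independence and Tonelli the `j`-th pair is integrated with the others frozen, where the
bound is uniform in the frozen columns. -/
theorem lintegral_inverseResidual_sq_le {s : ℕ} (j : Fin (s + 1)) {γ : Measure (H₂ × H₂)}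
    [IsProbabilityMeasure γ] {K : ℝ≥0}
    (hK : ∀ v : Fin s → H₂, ∫⁻ y, (residual y v)⁻¹ ^ 2 ∂γ.map Prod.snd ≤ K) :
    ∫⁻ S, inverseResidual j S ^ 2 ∂(Measure.pi fun _ => γ) ≤ K := by
  let f : (H₂ × H₂) × (Fin s → H₂ × H₂) → ℝ≥0∞ :=
    fun q => (residual q.1.2 (fun i => (q.2 i).2))⁻¹ ^ 2
  have hf : Measurable f :=
    ((measurable_residual s).comp (f := fun q : (H₂ × H₂) × (Fin s → H₂ × H₂) =>
      (q.1.2, fun i => (q.2 i).2)) (by fun_prop)).inv.pow_const 2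
  have hmp := measurePreserving_piFinSuccAbove (fun _ : Fin (s + 1) => γ) j
  have h := hmp.lintegral_comp hf
  refine h.trans_le ?_
  rw [lintegral_prod_symm' f hf]
  calc _ ≤ ∫⁻ _ : Fin s → H₂ × H₂, (K : ℝ≥0∞) ∂(Measure.pi fun _ => γ) := by
        refine lintegral_mono fun S => ?_
        refine le_trans (le_of_eq ?_) (hK fun i => (S i).2)
        rw [lintegral_map _ measurable_snd]
        exact ((measurable_residual s).comp (measurable_id.prodMk measurable_const)).inv.pow_const 2
    _ = K := by simp

/-- Cauchy–Schwarz separates the column distances, which see the coupling, from the inverse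
residuals, which see only its second marginal. -/
theorem lintegral_perturbation_le {s : ℕ} {γ : Measure (H₂ × H₂)} [IsProbabilityMeasure γ] {K : ℝ≥0}
    (hK : ∀ v : Fin s → H₂, ∫⁻ y, (residual y v)⁻¹ ^ 2 ∂γ.map Prod.snd ≤ K)
    (Q : H₂ →L[ℝ] H₂) {h : ℝ≥0∞} (hh : ∫⁻ q, ‖q.2 - Q q.1‖ₑ ^ 2 ∂γ = h ^ 2) :
    ∫⁻ S, perturbation (fun j => (S j).2) (fun j => Q (S j).1)
      ∂(Measure.pi fun _ : Fin (s + 1) => γ) ≤ (s + 1) * (h * (K : ℝ≥0∞) ^ (1 / 2 : ℝ)) := by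
  have : SecondCountableTopology H₂ := UniformSpace.secondCountable_of_separable H₂
  have hf (j : Fin (s + 1)) : Measurable fun S : Fin (s + 1) → H₂ × H₂ => ‖(S j).2 - Q (S j).1‖ₑ := by
    fun_prop
  have hj (j : Fin (s + 1)) : ∫⁻ S : Fin (s + 1) → H₂ × H₂,
      ‖(S j).2 - Q (S j).1‖ₑ * inverseResidual j S ∂(Measure.pi fun _ => γ) ≤
      h * (K : ℝ≥0∞) ^ (1 / 2 : ℝ) := by
    have hcs := ENNReal.lintegral_mul_le_Lp_mul_Lq (Measure.pi fun _ : Fin (s + 1) => γ)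
      Real.HolderConjugate.two_two (hf j).aemeasurable (measurable_inverseResidual j).aemeasurable
    refine hcs.trans ?_
    simp only [ENNReal.rpow_two]
    gcongr
    · have hev := (measurePreserving_eval (fun _ : Fin (s + 1) => γ) j).lintegral_comp
        (f := fun q => ‖q.2 - Q q.1‖ₑ ^ 2) (by fun_prop)
      simp only [Function.eval] at hev
      rw [hev, hh, ← ENNReal.rpow_natCast, ← ENNReal.rpow_mul]
      norm_num
    · exact lintegral_inverseResidual_sq_le j hK
  change ∫⁻ S : Fin (s + 1) → H₂ × H₂, ∑ j, ‖(S j).2 - Q (S j).1‖ₑ * inverseResidual j S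
    ∂(Measure.pi fun _ => γ) ≤ _
  rw [lintegral_finsetSum _ fun j _ => by exact (hf j).mul (measurable_inverseResidual j)]
  refine (Finset.sum_le_sum fun j _ => hj j).trans_eq ?_
  simp

/-- A finite second moment of the inverse residual excludes the value `∞` almost surely. -/
theorem ae_residual_ne_zero {s : ℕ} {γ : Measure (H₂ × H₂)} [IsProbabilityMeasure γ] {K : ℝ≥0}
    (hK : ∀ v : Fin s → H₂, ∫⁻ y, (residual y v)⁻¹ ^ 2 ∂γ.map Prod.snd ≤ K) :
    ∀ᵐ S ∂(Measure.pi fun _ : Fin (s + 1) => γ), ∀ j,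
      residual (S j).2 (fun i => (S (j.succAbove i)).2) ≠ 0 := by
  refine ae_all_iff.2 fun j => ?_
  filter_upwards [ae_lt_top ((measurable_inverseResidual j).pow_const 2)
    ((lintegral_inverseResidual_sq_le j hK).trans_lt ENNReal.coe_lt_top).ne] with S hS h0
  simp [inverseResidual, h0] at hS

theorem exists_coupledError_le {r : ℕ} {A : H₁ →L[ℝ] H₂} (hA : IsHilbertSchmidt A)
    (hrank : ((r + 2 : ℕ) : Cardinal) ≤ LinearMap.rank (A : H₁ →ₗ[ℝ] H₂)) :
    ∃ C : ℝ≥0, ∀ (m n : ℕ) (w : Fin n → H₁) (z : Fin m → H₂), Orthonormal ℝ w → Orthonormal ℝ z →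
      coupledError A r w z ≤ C * hsNorm (A - compression A w z) := by
  cases r with
  -- Without columns both spans are zero and only the compression error remains.
  | zero =>
    refine ⟨1, fun m n w z hw hz => ?_⟩
    obtain ⟨γ, hγ, hprob, -⟩ := exists_coupling hA hw z
    refine (iInf₂_le γ hγ).trans ?_
    have hle (S : Fin 0 → H₂ × H₂) : sampleError A w z S ≤ hsNorm (A - compression A w z) := by
      refine (sampleError_le A w hz S).trans_eq ?_
      rw [Subsingleton.elim (fun j => (S j).2) (fun j => frameProj z (S j).1),
        sub_self, ← ofReal_norm, norm_zero, ENNReal.ofReal_zero, zero_mul, add_zero]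
    exact (lintegral_mono hle).trans_eq (by simp)
  | succ s =>
    -- With `r = s + 1`, the required rank `s + 3` is exactly `r + 2`.
    obtain ⟨K, hK⟩ := exists_lintegral_inv_residual_sq_le (s := s) hrank
    have hK := hK _ (isCenteredGaussian_sketchMeasure hA)
    have hA' : hsNorm A ≠ ∞ := ne_of_lt hA
    have hKt : (K : ℝ≥0∞) ^ (1 / 2 : ℝ) ≠ ∞ :=
      ENNReal.rpow_ne_top_of_nonneg (by norm_num) ENNReal.coe_ne_top
    have hC : 1 + 4 * ((s + 1) * (K : ℝ≥0∞) ^ (1 / 2 : ℝ)) * hsNorm A ≠ ∞ := by finiteness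
    -- The 1 is the compression error; the 4 comes from the projector bound, and each of the `s + 1`
    -- columns contributes `√K`.
    refine ⟨(1 + 4 * ((s + 1) * (K : ℝ≥0∞) ^ (1 / 2 : ℝ)) * hsNorm A).toNNReal,
      fun m n w z hw hz => ?_⟩
    rw [ENNReal.coe_toNNReal hC]
    obtain ⟨γ, hγ, hprob, hd⟩ := exists_coupling hA hw z
    refine (iInf₂_le γ hγ).trans ?_
    rw [← hγ.2] at hK
    set h := hsNorm (A - compression A w z)
    calc _ ≤ ∫⁻ S, (h + 4 * perturbation (fun j => (S j).2) (fun j => frameProj z (S j).1) *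
          hsNorm A) ∂(Measure.pi fun _ : Fin (s + 1) => γ) := by
          refine lintegral_mono_ae ?_
          filter_upwards [ae_residual_ne_zero hK] with S hS
          refine (sampleError_le A w hz S).trans ?_
          gcongr
          exact enorm_starProjection_sub_le _ _ hS
      _ = h + 4 * (∫⁻ S, perturbation (fun j => (S j).2) (fun j => frameProj z (S j).1)
          ∂(Measure.pi fun _ : Fin (s + 1) => γ)) * hsNorm A := by
          rw [lintegral_add_left measurable_const, lintegral_mul_const' _ _ hA',
            lintegral_const_mul' _ _ (by norm_num)]
          simp
      _ ≤ h + 4 * ((s + 1) * (h * (K : ℝ≥0∞) ^ (1 / 2 : ℝ))) * hsNorm A := by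
          gcongr
          exact lintegral_perturbation_le hK _ hd
      _ = _ := by ring

end
end RandSVD

theorem mainTheorem3 {H₁ H₂ : Type*}
    [NormedAddCommGroup H₁] [InnerProductSpace ℝ H₁] [CompleteSpace H₁] [SeparableSpace H₁]
    [NormedAddCommGroup H₂] [InnerProductSpace ℝ H₂] [CompleteSpace H₂] [SeparableSpace H₂]
    [MeasurableSpace H₂] [BorelSpace H₂]
    (k p : ℕ) (A : H₁ →L[ℝ] H₂) (hA : RandSVD.IsHilbertSchmidt A)
    (hrank : ((k + p + 2 : ℕ) : Cardinal) ≤ LinearMap.rank (A : H₁ →ₗ[ℝ] H₂))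
    (w : ∀ n : ℕ, Fin n → H₁) (hw : ∀ n, Orthonormal ℝ (w n))
    (z : ∀ m : ℕ, Fin m → H₂) (hz : ∀ m, Orthonormal ℝ (z m))
    (hconv : Tendsto (fun q : ℕ × ℕ => RandSVD.hsNorm (A - RandSVD.compression A (w q.2) (z q.1)))
      atTop (𝓝 0)) :
    (∀ m n : ℕ, Measurable fun S : Fin (k + p) → H₂ × H₂ =>
      RandSVD.sampleError A (w n) (z m) S) ∧
    (∃ C : ℝ≥0, ∀ m n : ℕ, RandSVD.coupledError A (k + p) (w n) (z m) ≤
      C * RandSVD.hsNorm (A - RandSVD.compression A (w n) (z m))) ∧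
    Tendsto (fun q : ℕ × ℕ => RandSVD.coupledError A (k + p) (w q.2) (z q.1)) atTop (𝓝 0) := by
  obtain ⟨C, hC⟩ := RandSVD.exists_coupledError_le hA hrank
  refine ⟨fun m n => RandSVD.measurable_sampleError A _ (w n) (hz m),
    ⟨C, fun m n => hC m n (w n) (z m) (hw n) (hz m)⟩, ?_⟩
  have h := ENNReal.Tendsto.const_mul (a := (C : ℝ≥0∞)) hconv (.inr ENNReal.coe_ne_top)
  rw [mul_zero] at h
  exact tendsto_of_tendsto_of_tendsto_of_le_of_le tendsto_const_nhds h (fun _ => zero_le)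
    fun q => hC q.1 q.2 (w q.2) (z q.1) (hw q.2) (hz q.1)
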